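/- **Setting.** Let $(\mu_\alpha,c_\alpha)$ be a net (indexed by a non-empty directed set) of Borel probability measures $\mu_\alpha$ on $\mathbb R$ and reals $c_\alpha>0$ with $c_\alpha\to 0$. For $t\in\mathbb R$ put $$\overline L(t)=\limsup_\alpha c_\alpha\log\int_{\mathbb R}e^{c_\alpha^{-1}tx}\,\mu_\alpha(dx)\in[-\infty,+\infty];$$ when this upper limit is a limit, we say that $L(t)$ exists. Let $\overline L'_r$ be the right derivative map of the convex function $\overline L$, where for $t\ge 0$ we put $\overline L'_r(t)=+\infty$ if $\overline L(s)=+\infty$ for all $s>t$, and $\overline L'_r(t)=-\infty$ if $\overline L(s)=-\infty$ for some $s>t$. A superscript $^+$ denotes a limit from the right: $\overline L(t^+)=\lim_{s\downarrow t}\overline L(s)$ and $\overline L'_r(t^+)=\lim_{s\downarrow t}\overline L'_r(s)$. For $t\ge0$ let $\tilde t=\sup\{s>t:\overline L_{|\,]t,s]}\text{ is affine}\}$, with $\tilde t=t$ if this set is empty. Let $\overline L^*(x)=\sup_{t\in\mathbb R}\{tx-\overline L(t)\}$ for $x\in\mathbb R$, and $\overline L^*(-\infty)=-\overline L(0^+)$.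 The measures $\mu_\alpha$ are regarded as measures on $[-\infty,+\infty]$, $\log 0=-\infty$, and $0\cdot(-\infty)=0$. **Statement.** Let $\lambda\ge 0$ and $\varepsilon>0$. Assume that $\overline L$ is real-valued and differentiable on $]\lambda,\lambda+\varepsilon[$ and that $\sup\{\overline L'(t):t\in\,]\lambda,\lambda+\varepsilon[\}$ is not a maximum; when $\lambda=0$ and $\overline L'_r(0^+)=-\infty$, assume moreover that $\overline L$ is right continuous at $0$. Write $\overline L'_l(\lambda+\varepsilon)=\lim_{t\uparrow\lambda+\varepsilon}\overline L'(t)$ (this is the left derivative at $\lambda+\varepsilon$ when $\overline L$ is left continuous there). (a) For each $z\in[\overline L'_r(\lambda^+),\overline L'_l(\lambda+\varepsilon)[$ there exists $t_z\in[\lambda,\lambda+\varepsilon[$ with $\overline L'_r(t_z^+)=z$. For each such $t_z$, each net $(x_\alpha)$ in $[-\infty,+\infty]$ converging to $z$ and each net $(y_\alpha)$ in $[-\infty,+\infty]$ with $\liminf_\alpha y_\alpha>z$, $$\limsup_\alpha c_\alpha\log\mu_\alpha([x_\alpha,y_\alpha])=\limsup_\alpha c_\alpha\log\mu_\alpha(]x_\alpha,y_\alpha[)=\overline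 L(t_z^+)-t_zz.$$ If $z\ne-\infty$, this value equals $-\overline L^*(z)=\inf_{t>0}\{\overline L(t)-tz\}$. If $z=-\infty$ (which occurs only if $\lambda=0$ and $z=\overline L'_r(0^+)=-\infty$), it equals $-\lim_\alpha\overline L^*(x_\alpha)=0$. Furthermore, if there is a sequence $(t_i)$ in $]\tilde t_z,+\infty[$ converging to $\tilde t_z$ such that $L(t_i)$ exists for all $i$, then both upper limits above are limits. (b) The map $z\mapsto\overline L(t_z^+)-t_zz$ on $[\overline L'_r(\lambda^+),\overline L'_l(\lambda+\varepsilon)[$ (for any choice of the points $t_z$) is $]-\infty,0]$-valued, strictly decreasing and continuous; it is unbounded below if and only if $\overline L'_l(\lambda+\varepsilon)=+\infty$; it vanishes at $\overline L'_r(\lambda^+)$ if and only if either $\lambda>0$, $\overline L$ is differentiable at $\lambda$ and linear on $[0,\lambda]$, or $\lambda=0$ and $\overline L$ is right continuous at $0$. Its restriction to $]\overline L'_r(\lambda^+),\overline L'_l(\lambda+\varepsilon)[$ is strictly concave, and this restriction is differentiable if $\overline L$ is strictly convex on $]\tilde\lambda,\lambda+\varepsilon[$. -/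

import Mathlib

open Filter Topology MeasureTheory Set

noncomputable section

namespace PlachkySteinebach

/-- `c * log ∫ exp (c⁻¹ * t * x) μ(dx)`, as an extended real number; the integral of the positive
function is always defined, possibly infinite. -/
def logMoment (μ : Measure ℝ) (c t : ℝ) : EReal :=
  (c : EReal) * ENNReal.log (∫⁻ x, ENNReal.ofReal (Real.exp (c⁻¹ * t * x)) ∂μ)

/-- The generalized log-moment generating function: the upper limit of `logMoment` along the
net. -/
def upperLMGF {ι : Type*} [Preorder ι] (μ : ι → Measure ℝ) (c : ι → ℝ) (t : ℝ) : EReal :=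
  limsup (fun α => logMoment (μ α) (c α) t) atTop

/-- The upper limit defining the generalized log-moment generating function at `t` is a limit. -/
def LMGFExists {ι : Type*} [Preorder ι] (μ : ι → Measure ℝ) (c : ι → ℝ) (t : ℝ) : Prop :=
  Tendsto (fun α => logMoment (μ α) (c α) t) atTop (𝓝 (upperLMGF μ c t))

/-- `c * log μ([x, y])` with extended real end-points; `μ` is viewed as a measure on
`[-∞, +∞]` carried by the real line, and `log 0 = -∞`. -/
def logClosed (μ : Measure ℝ) (c : ℝ) (x y : EReal) : EReal :=
  (c : EReal) * ENNReal.log (μ ((fun r : ℝ => (r : EReal)) ⁻¹' Icc x y))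

/-- `c * log μ(]x, y[)` with extended real end-points. -/
def logOpen (μ : Measure ℝ) (c : ℝ) (x y : EReal) : EReal :=
  (c : EReal) * ENNReal.log (μ ((fun r : ℝ => (r : EReal)) ⁻¹' Ioo x y))

open Classical in
/-- The right derivative of an extended real valued function (used for convex functions):
`-∞` if the function takes the value `-∞` to the right of `t`, `+∞` if it is identically `+∞` to
the right of `t`, and otherwise the limit of the difference quotients as `s` decreases to `t`
(written as an upper limit, which is the limit whenever the latter exists, hence always for convex
functions). -/
def rightDeriv (L : ℝ → EReal) (t : ℝ) : EReal :=
  if ∃ s, t < s ∧ L s = ⊥ then ⊥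
  else if ∀ s, t < s → L s = ⊤ then ⊤
  else limsup (fun s => (L s - L t) / ((s - t : ℝ) : EReal)) (𝓝[>] t)

/-- The left derivative: the limit of the difference quotients as `s` increases to `t` (written as
an upper limit); used only at points around which the function is finite. -/
def leftDeriv (L : ℝ → EReal) (t : ℝ) : EReal :=
  limsup (fun s => (L t - L s) / ((t - s : ℝ) : EReal)) (𝓝[<] t)

/-- `L` is real-valued around `t` and differentiable at `t`. -/
def DiffAt (L : ℝ → EReal) (t : ℝ) : Prop :=
  (∀ᶠ s in 𝓝 t, L s ≠ ⊥ ∧ L s ≠ ⊤) ∧ DifferentiableAt ℝ (fun s => (L s).toReal) t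

/-- The derivative of `L`, meant at points `t` with `DiffAt L t`. -/
def derivAt (L : ℝ → EReal) (t : ℝ) : ℝ :=
  deriv (fun s => (L s).toReal) t

/-- `L` coincides on `S` with a real affine function. -/
def AffineOn (L : ℝ → EReal) (S : Set ℝ) : Prop :=
  ∃ p q : ℝ, ∀ s ∈ S, L s = ((p * s + q : ℝ) : EReal)

/-- `L` coincides on `S` with a real linear function. -/
def LinearOn (L : ℝ → EReal) (S : Set ℝ) : Prop :=
  ∃ p : ℝ, ∀ s ∈ S, L s = ((p * s : ℝ) : EReal)

/-- `sup {s > t : L is affine on ]t, s]}`, equal to `t` when there is no such `s` (allowing `s = t`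
below, where `]t, s]` is empty, has precisely this effect). -/
def affineEnd (L : ℝ → EReal) (t : ℝ) : ℝ :=
  sSup {s | t ≤ s ∧ AffineOn L (Ioc t s)}

open Classical in
/-- The Legendre-Fenchel transform `x ↦ sup_t (t x - L t)`, extended to `-∞` by the value
`-L(0⁺)`. (At `x = +∞` the value is irrelevant.) -/
def legendre (L : ℝ → EReal) (x : EReal) : EReal :=
  if x = ⊥ then -Function.rightLim L 0
  else ⨆ t : ℝ, ((t : EReal) * x - L t)

/-- `L(t⁺) - t z`, with the convention `0 * (-∞) = 0`. -/
def value (L : ℝ → EReal) (t : ℝ) (z : EReal) : EReal :=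
  Function.rightLim L t - (t : EReal) * z

end PlachkySteinebach

end

noncomputable section

namespace PlachkySteinebach

/-! ### Exponential estimates along the net -/

/-! By Hölder's inequality (`upperLMGF_convex`) the generating function `L` is convex, with `L 0 =
0`. Where it is differentiable its tangents minorize it on all of `ℝ` (`ConvexDiff.tangent_le`), and
`L(t⁺) - t z` is the limit, as `s ↓ t`, of the intercepts at `0` of the tangents at `s`
(`ConvexDiff.exists_value_eq`).

The upper bound is Chebyshev's inequality with exponent `s`, followed by `s ↓ t`. The lower bound
tilts the measures at a point `s` slightly beyond the end of the affine piece starting at `t`. There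
the slope is strictly above `z` but close to it, so it has a neighbourhood `]l, r[` eventually
contained in `]x_α, y_α[`. Moments at two points around `s` show that mass outside `]l, r[`
contributes too little to the moment at `s`; hence `]l, r[` carries mass of exponential order at
least about the intercept at `s`. This holds at each late index where the moment at `s` is nearly as
large as its upper limit: frequently in general, eventually when `L(s)` is a limit. These two cases
give the bounds on the upper and lower limits.

For part (b), the value at a real `z` is `inf_{s>0} (L s - s z)`, so it does not depend on the
choice of `t_z`, and `-t_z` is a supergradient of the value at `z` (`RateData.rate_le`). Since `0 ≤
t_z < lam + ε`, monotonicity, continuity at real points and the boundedness criterion follow; the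
strict form `RateData.rate_lt` gives strict concavity, and continuity of `z ↦ t_z` gives
differentiability. -/

theorem log_ofReal_exp (y : ℝ) : ENNReal.log (ENNReal.ofReal (Real.exp y)) = (y : EReal) := by
  rw [ENNReal.log_ofReal, if_neg (not_le.2 (Real.exp_pos y)), Real.log_exp]

theorem coe_mul_log_le_iff {c K : ℝ} (hc : 0 < c) (X : ENNReal) :
    (c : EReal) * ENNReal.log X ≤ (K : EReal) ↔ X ≤ ENNReal.ofReal (Real.exp (K / c)) := by
  rw [← ENNReal.log_le_log_iff, log_ofReal_exp]
  generalize ENNReal.log X = Y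
  induction Y using EReal.rec with
  | bot => simp [EReal.coe_mul_bot_of_pos hc]
  | top => simp [EReal.coe_mul_top_of_pos hc]
  | coe y =>
    rw [← EReal.coe_mul, EReal.coe_le_coe_iff, EReal.coe_le_coe_iff, le_div_iff₀ hc, mul_comm]

theorem ofReal_exp_mul (a b : ℝ) : ENNReal.ofReal (Real.exp a) * ENNReal.ofReal (Real.exp b)
    = ENNReal.ofReal (Real.exp (a + b)) := by
  rw [Real.exp_add, ENNReal.ofReal_mul (Real.exp_pos a).le]

theorem ofReal_exp_mono {a b : ℝ} (h : a ≤ b) :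
    ENNReal.ofReal (Real.exp a) ≤ ENNReal.ofReal (Real.exp b) :=
  ENNReal.ofReal_le_ofReal (Real.exp_le_exp.2 h)

theorem measurable_expMul (c t : ℝ) :
    Measurable fun x : ℝ => ENNReal.ofReal (Real.exp (c⁻¹ * t * x)) := by
  fun_prop

theorem logOpen_le_logClosed {μ : Measure ℝ} {c : ℝ} (hc : 0 < c) (x y : EReal) :
    logOpen μ c x y ≤ logClosed μ c x y := by
  unfold logOpen logClosed
  refine mul_le_mul_of_nonneg_left (ENNReal.log_le_log_iff.2 (measure_mono ?_))
    (EReal.coe_nonneg.2 hc.le)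
  exact preimage_mono Ioo_subset_Icc_self

theorem logClosed_le_zero {μ : Measure ℝ} [IsProbabilityMeasure μ] {c : ℝ} (hc : 0 < c)
    (x y : EReal) : logClosed μ c x y ≤ 0 := by
  unfold logClosed
  rw [← EReal.coe_zero, coe_mul_log_le_iff hc]
  simpa using prob_le_one

section Net

variable {ι : Type*} [Preorder ι] {μ : ι → Measure ℝ} {c : ι → ℝ}

theorem eventually_lintegral_le (hc : ∀ α, 0 < c α) {t K : ℝ}
    (h : upperLMGF μ c t < (K : EReal)) :
    ∀ᶠ α in atTop, ∫⁻ x, ENNReal.ofReal (Real.exp ((c α)⁻¹ * t * x)) ∂(μ α)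
      ≤ ENNReal.ofReal (Real.exp (K / c α)) := by
  filter_upwards [eventually_lt_of_limsup_lt h] with α hα
  exact (coe_mul_log_le_iff (hc α) _).1 hα.le

theorem upperLMGF_zero [IsDirectedOrder ι] [Nonempty ι] (hμ : ∀ α, IsProbabilityMeasure (μ α)) :
    upperLMGF μ c 0 = 0 := by
  have : (fun α => logMoment (μ α) (c α) 0) = fun _ => (0 : EReal) := by
    funext α
    simp [logMoment]
  rw [upperLMGF, this, limsup_const]

/-- Hölder's inequality with weights `p`, `q` at each index. Stating convexity through real upper
bounds `A`, `B` avoids the sum of `⊤` and `⊥` in `EReal`. -/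
theorem upperLMGF_convex (hc : ∀ α, 0 < c α) {s u A B p q : ℝ} (hp : 0 ≤ p) (hq : 0 ≤ q)
    (hpq : p + q = 1) (hs : upperLMGF μ c s ≤ (A : EReal)) (hu : upperLMGF μ c u ≤ (B : EReal)) :
    upperLMGF μ c (p * s + q * u) ≤ ((p * A + q * B : ℝ) : EReal) := by
  refine EReal.le_of_forall_lt_iff_le.1 fun K hK => ?_
  rw [EReal.coe_lt_coe_iff] at hK
  set η := K - (p * A + q * B) with hη
  have hη0 : 0 < η := by linarith
  have h1 := eventually_lintegral_le hc
    (hs.trans_lt (EReal.coe_lt_coe_iff.2 (by linarith : A < A + η)))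
  have h2 := eventually_lintegral_le hc
    (hu.trans_lt (EReal.coe_lt_coe_iff.2 (by linarith : B < B + η)))
  refine limsup_le_of_le (h := ?_)
  filter_upwards [h1, h2] with α h1 h2
  refine (coe_mul_log_le_iff (hc α) _).2 ?_
  calc ∫⁻ x, ENNReal.ofReal (Real.exp ((c α)⁻¹ * (p * s + q * u) * x)) ∂(μ α)
      = ∫⁻ x, ENNReal.ofReal (Real.exp ((c α)⁻¹ * s * x)) ^ p
          * ENNReal.ofReal (Real.exp ((c α)⁻¹ * u * x)) ^ q ∂(μ α) := by
        refine lintegral_congr fun x => ?_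
        rw [ENNReal.ofReal_rpow_of_pos (Real.exp_pos _), ENNReal.ofReal_rpow_of_pos
          (Real.exp_pos _), ← Real.exp_mul, ← Real.exp_mul, ofReal_exp_mul]
        ring_nf
    _ ≤ _ := ENNReal.lintegral_mul_norm_pow_le (measurable_expMul _ _).aemeasurable
        (measurable_expMul _ _).aemeasurable hp hq hpq
    _ ≤ ENNReal.ofReal (Real.exp ((A + η) / c α)) ^ p
          * ENNReal.ofReal (Real.exp ((B + η) / c α)) ^ q := by gcongr
    _ = ENNReal.ofReal (Real.exp (K / c α)) := by
        rw [ENNReal.ofReal_rpow_of_pos (Real.exp_pos _), ENNReal.ofReal_rpow_of_pos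
          (Real.exp_pos _), ← Real.exp_mul, ← Real.exp_mul, ofReal_exp_mul]
        congr 2
        have : K = (A + η) * p + (B + η) * q := by
          have : η * (p + q) = η := by rw [hpq, mul_one]
          linarith
        rw [this]
        ring

/-- Chebyshev's exponential inequality along the net. -/
theorem limsup_logClosed_le (hc : ∀ α, 0 < c α) {s K v : ℝ} (hs : 0 < s)
    (hK : upperLMGF μ c s < (K : EReal)) {x y : ι → EReal}
    (hx : ∀ᶠ α in atTop, (v : EReal) ≤ x α) :
    limsup (fun α => logClosed (μ α) (c α) (x α) (y α)) atTop ≤ ((K - s * v : ℝ) : EReal) := by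
  refine limsup_le_of_le (h := ?_)
  filter_upwards [eventually_lintegral_le hc hK, hx] with α h1 hx
  refine (coe_mul_log_le_iff (hc α) _).2 ?_
  have hcα := hc α
  set T : Set ℝ := {r | ENNReal.ofReal (Real.exp ((c α)⁻¹ * s * v))
        ≤ ENNReal.ofReal (Real.exp ((c α)⁻¹ * s * r))} with hT
  have hsub : (fun r : ℝ => (r : EReal)) ⁻¹' Icc (x α) (y α)
      ⊆ T := by
    rintro r ⟨hr, -⟩
    have hvr : v ≤ r := EReal.coe_le_coe_iff.1 (hx.trans hr)
    refine ofReal_exp_mono ?_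
    gcongr
  have h2 := (mul_meas_ge_le_lintegral (μ := μ α) (measurable_expMul (c α) s)
    (ENNReal.ofReal (Real.exp ((c α)⁻¹ * s * v)))).trans h1
  calc μ α _ ≤ _ := measure_mono hsub
    _ = ENNReal.ofReal (Real.exp (-((c α)⁻¹ * s * v))) *
        (ENNReal.ofReal (Real.exp ((c α)⁻¹ * s * v)) * μ α T) := by
        rw [← mul_assoc, ofReal_exp_mul]; simp
    _ ≤ ENNReal.ofReal (Real.exp (-((c α)⁻¹ * s * v))) *
        ENNReal.ofReal (Real.exp (K / c α)) := by gcongr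
    _ = _ := by
      rw [ofReal_exp_mul]
      congr 2
      field_simp
      ring

/-- Exponential tilting: if the exponential moments at `s + h₁` and `s - h₂` are too small, then
the moment at `s` can only be large because of the mass of the interval `]l, r[`. -/
theorem exists_eventually_lt_logOpen (hc : ∀ α, 0 < c α) (hc0 : Tendsto c atTop (𝓝 0))
    {s F A l r h₁ h₂ : ℝ} (hs : 0 < s) (h₁0 : 0 < h₁) (h₂0 : 0 < h₂)
    (hup : upperLMGF μ c (s + h₁) < ((F + h₁ * r : ℝ) : EReal))
    (hlo : upperLMGF μ c (s - h₂) < ((F - h₂ * l : ℝ) : EReal))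
    (hA : A + s * r < F) {x y : ι → EReal} (hx : ∀ᶠ α in atTop, x α ≤ (l : EReal))
    (hy : ∀ᶠ α in atTop, (r : EReal) ≤ y α) :
    ∃ B : ℝ, B < F ∧ ∀ᶠ α in atTop, (B : EReal) < logMoment (μ α) (c α) s →
      (A : EReal) < logOpen (μ α) (c α) (x α) (y α) := by
  obtain ⟨K₁, hK₁, hK₁F⟩ := EReal.lt_iff_exists_real_btwn.1 hup
  obtain ⟨K₂, hK₂, hK₂F⟩ := EReal.lt_iff_exists_real_btwn.1 hlo
  rw [EReal.coe_lt_coe_iff] at hK₁F hK₂F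
  -- `M` dominates the exponential rates of the three pieces of the integral (right of `r`, left of
  -- `l`, in between). The threshold is then the midpoint of `M` and `F`, and the remaining gap
  -- absorbs the factor `3` from adding three terms.
  obtain ⟨M, hM₁, hM₂, hM₃, hMF⟩ : ∃ M, K₁ - h₁ * r ≤ M ∧ K₂ + h₂ * l ≤ M ∧ A + s * r ≤ M ∧
      M < F := ⟨max (max (K₁ - h₁ * r) (K₂ + h₂ * l)) (A + s * r), by simp, by simp, by simp,
        max_lt (max_lt (by linarith) (by linarith)) hA⟩
  refine ⟨(M + F) / 2, by linarith, ?_⟩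
  have hc3 : ∀ᶠ α in atTop, c α * Real.log 3 ≤ (F - M) / 2 := by
    have : Tendsto (fun α => c α * Real.log 3) atTop (𝓝 (0 * Real.log 3)) := hc0.mul_const _
    rw [zero_mul] at this
    exact (this.eventually_lt_const (by linarith)).mono fun _ h => h.le
  filter_upwards [eventually_lintegral_le hc hK₁, eventually_lintegral_le hc hK₂, hx, hy, hc3]
    with α h1 h2 hx hy h3
  contrapose!
  intro hO
  have hcα := hc α
  set O : Set ℝ := (fun r : ℝ => (r : EReal)) ⁻¹' Ioo (x α) (y α) with hOdef
  have hOm : MeasurableSet O := measurable_coe_real_ereal measurableSet_Ioo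
  have hO' : μ α O ≤ ENNReal.ofReal (Real.exp (A / c α)) :=
    (coe_mul_log_le_iff hcα _).1 hO
  refine (coe_mul_log_le_iff hcα _).2 ?_
  calc ∫⁻ z, ENNReal.ofReal (Real.exp ((c α)⁻¹ * s * z)) ∂(μ α)
      ≤ ∫⁻ z, (ENNReal.ofReal (Real.exp (-(h₁ * r) / c α)) *
          ENNReal.ofReal (Real.exp ((c α)⁻¹ * (s + h₁) * z)) +
          ENNReal.ofReal (Real.exp ((h₂ * l) / c α)) *
          ENNReal.ofReal (Real.exp ((c α)⁻¹ * (s - h₂) * z)) +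
          ENNReal.ofReal (Real.exp ((s * r) / c α)) * O.indicator 1 z) ∂(μ α) := by
        -- Pointwise, one of the three terms suffices: the moment at `s + h₁` for `z ≥ r`, the
        -- moment at `s - h₂` for `z ≤ l`, and the indicator otherwise.
        refine lintegral_mono fun z => ?_
        rw [ofReal_exp_mul, ofReal_exp_mul]
        rcases le_or_gt r z with hz | hz
        · refine le_add_right (le_add_right (ofReal_exp_mono ?_))
          have : (c α)⁻¹ * (s * z) ≤ (c α)⁻¹ * (-(h₁ * r) + (s + h₁) * z) := by
            gcongr
            nlinarith
          calc _ = (c α)⁻¹ * (s * z) := by ring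
            _ ≤ _ := this
            _ = _ := by ring
        rcases le_or_gt z l with hz' | hz'
        · refine le_add_right (le_add_left (ofReal_exp_mono ?_))
          have : (c α)⁻¹ * (s * z) ≤ (c α)⁻¹ * (h₂ * l + (s - h₂) * z) := by
            gcongr
            nlinarith
          calc _ = (c α)⁻¹ * (s * z) := by ring
            _ ≤ _ := this
            _ = _ := by ring
        · have hzO : z ∈ O := ⟨hx.trans_lt (EReal.coe_lt_coe_iff.2 hz'),
            (EReal.coe_lt_coe_iff.2 hz).trans_le hy⟩
          refine le_add_left ?_
          rw [indicator_of_mem hzO, Pi.one_apply, mul_one]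
          refine ofReal_exp_mono ?_
          calc (c α)⁻¹ * s * z ≤ (c α)⁻¹ * s * r := by gcongr
            _ = _ := by ring
    _ = ENNReal.ofReal (Real.exp (-(h₁ * r) / c α)) *
          ∫⁻ z, ENNReal.ofReal (Real.exp ((c α)⁻¹ * (s + h₁) * z)) ∂(μ α) +
          ENNReal.ofReal (Real.exp ((h₂ * l) / c α)) *
          ∫⁻ z, ENNReal.ofReal (Real.exp ((c α)⁻¹ * (s - h₂) * z)) ∂(μ α) +
          ENNReal.ofReal (Real.exp ((s * r) / c α)) * μ α O := by
        have m1 := measurable_expMul (c α) (s + h₁)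
        have m2 := measurable_expMul (c α) (s - h₂)
        rw [lintegral_add_left (by fun_prop),
          lintegral_add_left (m1.const_mul _), lintegral_const_mul _ m1,
          lintegral_const_mul _ m2, lintegral_const_mul _ (measurable_one.indicator hOm),
          lintegral_indicator_one hOm]
    _ ≤ ENNReal.ofReal (Real.exp (-(h₁ * r) / c α)) * ENNReal.ofReal (Real.exp (K₁ / c α)) +
          ENNReal.ofReal (Real.exp ((h₂ * l) / c α)) * ENNReal.ofReal (Real.exp (K₂ / c α)) +
          ENNReal.ofReal (Real.exp ((s * r) / c α)) * ENNReal.ofReal (Real.exp (A / c α)) := by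
        gcongr
    _ ≤ ENNReal.ofReal (Real.exp (M / c α)) + ENNReal.ofReal (Real.exp (M / c α)) +
          ENNReal.ofReal (Real.exp (M / c α)) := by
        rw [ofReal_exp_mul, ofReal_exp_mul, ofReal_exp_mul, ← add_div, ← add_div, ← add_div]
        gcongr <;> linarith
    _ = ENNReal.ofReal (Real.exp (Real.log 3 + M / c α)) := by
        rw [← ENNReal.ofReal_add (Real.exp_pos _).le (Real.exp_pos _).le,
          ← ENNReal.ofReal_add (by positivity) (Real.exp_pos _).le, Real.exp_add,
          Real.exp_log (by norm_num)]
        congr 1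
        ring
    _ ≤ ENNReal.ofReal (Real.exp ((M + F) / 2 / c α)) := by
        refine ofReal_exp_mono ?_
        rw [le_div_iff₀ hcα, add_mul, div_mul_cancel₀ _ hcα.ne']
        linarith

end Net

/-! ### Extended real valued convex functions differentiable on an interval -/

/-- `L` is a convex extended real valued function with `L 0 = 0`, which is real-valued and
differentiable on `]lam, lam + ε[`. -/
structure ConvexDiff (L : ℝ → EReal) (lam ε : ℝ) : Prop where
  conv : ∀ {s u A B p q : ℝ}, 0 ≤ p → 0 ≤ q → p + q = 1 → L s ≤ (A : EReal) → L u ≤ (B : EReal) →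
    L (p * s + q * u) ≤ ((p * A + q * B : ℝ) : EReal)
  zero : L 0 = 0
  nonneg : 0 ≤ lam
  pos : 0 < ε
  diff : ∀ t ∈ Ioo lam (lam + ε), DiffAt L t

/-- The value at `0` of the tangent at `s`. -/
def intercept (L : ℝ → EReal) (s : ℝ) : ℝ := (L s).toReal - s * derivAt L s

namespace ConvexDiff

variable {L : ℝ → EReal} {lam ε : ℝ}

theorem lt_add (h : ConvexDiff L lam ε) : lam < lam + ε := by linarith [h.pos]

theorem coe_toReal (h : ConvexDiff L lam ε) {t : ℝ} (ht : t ∈ Ioo lam (lam + ε)) :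
    ((L t).toReal : EReal) = L t :=
  EReal.coe_toReal (h.diff t ht).1.self_of_nhds.2 (h.diff t ht).1.self_of_nhds.1

theorem hasDerivAt (h : ConvexDiff L lam ε) {t : ℝ} (ht : t ∈ Ioo lam (lam + ε)) :
    HasDerivAt (fun s => (L s).toReal) (derivAt L t) t :=
  (h.diff t ht).2.hasDerivAt

theorem continuousAt (h : ConvexDiff L lam ε) {t : ℝ} (ht : t ∈ Ioo lam (lam + ε)) :
    ContinuousAt (fun s => (L s).toReal) t :=
  (h.hasDerivAt ht).continuousAt

/-- Convexity on the segment from `t` to `s` bounds the difference quotients at `t` by the chord.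
The point `s` is arbitrary, even outside the interval or where `L` is infinite; hence the passage to
real `A` above `L s`. -/
theorem tangent_le (h : ConvexDiff L lam ε) {t : ℝ} (ht : t ∈ Ioo lam (lam + ε)) (s : ℝ) :
    (((L t).toReal + derivAt L t * (s - t) : ℝ) : EReal) ≤ L s := by
  refine EReal.le_of_forall_lt_iff_le.1 fun A hA => ?_
  rw [EReal.coe_le_coe_iff]
  have hline : HasDerivAt (fun p : ℝ => t + p * (s - t)) (s - t) 0 := by
    simpa using ((hasDerivAt_id (0 : ℝ)).mul_const (s - t)).const_add t
  have hg : HasDerivAt (fun p : ℝ => (L (t + p * (s - t))).toReal) (derivAt L t * (s - t)) 0 :=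
    HasDerivAt.comp (0 : ℝ) (h₂ := fun s => (L s).toReal) (by simpa using h.hasDerivAt ht) hline
  have hlim := hg.tendsto_slope_zero_right
  have hev : ∀ᶠ p : ℝ in 𝓝[>] 0, t + p * (s - t) ∈ Ioo lam (lam + ε) := by
    refine nhdsWithin_le_nhds (hline.continuousAt.eventually_mem ?_)
    simpa using Ioo_mem_nhds ht.1 ht.2
  have hle : derivAt L t * (s - t) ≤ A - (L t).toReal := by
    refine le_of_tendsto hlim ?_
    filter_upwards [hev, Ioo_mem_nhdsGT (zero_lt_one (α := ℝ))] with p hp hp1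
    have hc := h.conv (sub_nonneg.2 hp1.2.le) hp1.1.le (sub_add_cancel 1 p)
      (h.coe_toReal ht).ge hA.le
    rw [show (1 - p) * t + p * s = t + p * (s - t) by ring, ← h.coe_toReal hp,
      EReal.coe_le_coe_iff] at hc
    simp only [zero_add, zero_mul, add_zero, smul_eq_mul]
    rw [inv_mul_le_iff₀ hp1.1]
    linarith
  linarith

theorem tangent_le_toReal (h : ConvexDiff L lam ε) {t s : ℝ} (ht : t ∈ Ioo lam (lam + ε))
    (hs : s ∈ Ioo lam (lam + ε)) :
    (L t).toReal + derivAt L t * (s - t) ≤ (L s).toReal := by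
  have := h.tangent_le ht s
  rwa [← h.coe_toReal hs, EReal.coe_le_coe_iff] at this

theorem ne_bot (h : ConvexDiff L lam ε) (s : ℝ) : L s ≠ ⊥ := by
  have := h.tangent_le (t := lam + ε / 2) ⟨by linarith [h.pos], by linarith [h.pos]⟩ s
  intro hs
  rw [hs] at this
  exact EReal.coe_ne_bot _ (le_bot_iff.1 this)

theorem monotoneOn (h : ConvexDiff L lam ε) : MonotoneOn (derivAt L) (Ioo lam (lam + ε)) := by
  intro s hs t ht hst
  rcases hst.eq_or_lt with rfl | hst
  · exact le_rfl
  · have h1 := h.tangent_le_toReal hs ht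
    have h2 := h.tangent_le_toReal ht hs
    nlinarith

theorem intercept_le_zero (h : ConvexDiff L lam ε) {t : ℝ} (ht : t ∈ Ioo lam (lam + ε)) :
    intercept L t ≤ 0 := by
  have := h.tangent_le ht 0
  rw [h.zero, EReal.coe_nonpos] at this
  unfold intercept
  linarith

/-- A secant from `t` to a fixed nearby `v` has slope beyond `m`. This persists when `t` is replaced
by a nearby `s`, and the tangent inequality at `s` compares the derivative there with that secant.
-/
theorem continuousAt_derivAt (h : ConvexDiff L lam ε) {t : ℝ} (ht : t ∈ Ioo lam (lam + ε)) :
    ContinuousAt (derivAt L) t := by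
  have hI : Ioo lam (lam + ε) ∈ 𝓝 t := Ioo_mem_nhds ht.1 ht.2
  have hslope := (h.hasDerivAt ht).tendsto_slope
  refine tendsto_order.2 ⟨fun m hm => ?_, fun m hm => ?_⟩
  · have h1 : ∀ᶠ v in 𝓝[<] t, m < slope (fun s => (L s).toReal) t v :=
      (hslope.mono_left (nhdsWithin_mono _ fun v hv => ne_of_lt hv)).eventually_const_lt hm
    obtain ⟨v, hv, hvI, hvt⟩ := (h1.and (inter_mem (mem_nhdsWithin_of_mem_nhds hI)
      self_mem_nhdsWithin)).exists
    have hvt' : v < t := hvt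
    rw [slope_comm, slope_def_field, lt_div_iff₀ (by linarith)] at hv
    have h2 : ∀ᶠ s in 𝓝 t, m * (s - v) < (L s).toReal - (L v).toReal := by
      refine Tendsto.eventually_lt ?_ ((h.continuousAt ht).sub continuousAt_const) hv
      exact (continuousAt_const.mul (continuousAt_id.sub continuousAt_const))
    filter_upwards [h2, hI, Ioi_mem_nhds hvt'] with s hs hsI hvs
    have h3 := h.tangent_le_toReal hsI hvI
    have h4 : m * (s - v) < derivAt L s * (s - v) := by linarith
    exact lt_of_mul_lt_mul_right h4 (sub_nonneg.2 (le_of_lt hvs))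
  · have h1 : ∀ᶠ v in 𝓝[>] t, slope (fun s => (L s).toReal) t v < m :=
      (hslope.mono_left (nhdsWithin_mono _ fun v hv => ne_of_gt hv)).eventually_lt_const hm
    obtain ⟨v, hv, hvI, hvt⟩ := (h1.and (inter_mem (mem_nhdsWithin_of_mem_nhds hI)
      self_mem_nhdsWithin)).exists
    have hvt' : t < v := hvt
    rw [slope_def_field, div_lt_iff₀ (by linarith)] at hv
    have h2 : ∀ᶠ s in 𝓝 t, (L v).toReal - (L s).toReal < m * (v - s) := by
      refine Tendsto.eventually_lt (continuousAt_const.sub (h.continuousAt ht)) ?_ hv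
      exact (continuousAt_const.mul (continuousAt_const.sub continuousAt_id))
    filter_upwards [h2, hI, Iio_mem_nhds hvt'] with s hs hsI hvs
    have h3 := h.tangent_le_toReal hsI hvI
    have h4 : derivAt L s * (v - s) < m * (v - s) := by linarith
    exact lt_of_mul_lt_mul_right h4 (sub_nonneg.2 (le_of_lt hvs))

theorem continuousAt_intercept (h : ConvexDiff L lam ε) {t : ℝ} (ht : t ∈ Ioo lam (lam + ε)) :
    ContinuousAt (intercept L) t :=
  (h.continuousAt ht).sub (continuousAt_id.mul (h.continuousAt_derivAt ht))

theorem tendsto_quotient (h : ConvexDiff L lam ε) {t : ℝ} (ht : t ∈ Ioo lam (lam + ε)) :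
    Tendsto (fun s => (L s - L t) / ((s - t : ℝ) : EReal)) (𝓝[≠] t) (𝓝 (derivAt L t : EReal)) := by
  refine (EReal.tendsto_coe.2 (h.hasDerivAt ht).tendsto_slope).congr' ?_
  filter_upwards [mem_nhdsWithin_of_mem_nhds (Ioo_mem_nhds ht.1 ht.2)] with s hs
  rw [slope_def_field, EReal.coe_div, EReal.coe_sub, h.coe_toReal hs, h.coe_toReal ht]

theorem rightDeriv_eq (h : ConvexDiff L lam ε) {t : ℝ} (ht : t ∈ Ioo lam (lam + ε)) :
    rightDeriv L t = derivAt L t := by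
  have h2 : ¬ ∀ s, t < s → L s = ⊤ := by
    intro hs
    have hm : (t + (lam + ε)) / 2 ∈ Ioo lam (lam + ε) := ⟨by linarith [ht.1, ht.2], by linarith [ht.2]⟩
    have := h.coe_toReal hm
    rw [hs _ (by linarith [ht.2])] at this
    exact EReal.coe_ne_top _ this
  rw [rightDeriv, if_neg fun ⟨s, _, hs⟩ => h.ne_bot s hs, if_neg h2]
  have hle : 𝓝[>] t ≤ 𝓝[≠] t := nhdsWithin_mono _ fun v hv => ne_of_gt hv
  exact ((h.tendsto_quotient ht).mono_left hle).limsup_eq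

theorem leftDeriv_eq (h : ConvexDiff L lam ε) {t : ℝ} (ht : t ∈ Ioo lam (lam + ε)) :
    leftDeriv L t = derivAt L t := by
  refine Tendsto.limsup_eq ?_
  refine ((h.tendsto_quotient ht).mono_left
    (nhdsWithin_mono _ fun v hv => ne_of_lt hv)).congr' ?_
  filter_upwards [mem_nhdsWithin_of_mem_nhds (Ioo_mem_nhds ht.1 ht.2)] with s hs
  rw [← h.coe_toReal hs, ← h.coe_toReal ht, ← EReal.coe_sub, ← EReal.coe_sub, ← EReal.coe_div,
    ← EReal.coe_div, ← neg_sub, ← neg_sub t s, neg_div_neg_eq]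

theorem coe_monotoneOn (h : ConvexDiff L lam ε) :
    MonotoneOn (fun s => (derivAt L s : EReal)) (Ioo lam (lam + ε)) :=
  fun _ hs _ ht hst => EReal.coe_le_coe_iff.2 (h.monotoneOn hs ht hst)

/-- Monotonicity provides the limit as an infimum in `EReal`. Existence of the limit is what makes
`Function.rightLim` meaningful here rather than a default value. -/
theorem tendsto_derivAt (h : ConvexDiff L lam ε) {t : ℝ} (ht : t ∈ Ico lam (lam + ε)) :
    Tendsto (fun s => (derivAt L s : EReal)) (𝓝[>] t)
      (𝓝 (Function.rightLim (rightDeriv L) t)) := by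
  have h1 : Tendsto (fun s => (derivAt L s : EReal)) (𝓝[>] t)
      (𝓝 (sInf ((fun s => (derivAt L s : EReal)) '' Ioo t (lam + ε)))) :=
    (h.coe_monotoneOn.mono (Ioo_subset_Ioo_left ht.1)).tendsto_nhdsWithin_Ioo_right
      (nonempty_Ioo.2 ht.2) (OrderBot.bddBelow _)
  have h2 : Tendsto (rightDeriv L) (𝓝[>] t)
      (𝓝 (sInf ((fun s => (derivAt L s : EReal)) '' Ioo t (lam + ε)))) := by
    refine h1.congr' ?_
    filter_upwards [Ioo_mem_nhdsGT_of_mem ht] with s hs using (h.rightDeriv_eq hs).symm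
  rw [rightLim_eq_of_tendsto h2]
  exact h1

theorem rightLim_rightDeriv_eq (h : ConvexDiff L lam ε) {t : ℝ} (ht : t ∈ Ioo lam (lam + ε)) :
    Function.rightLim (rightDeriv L) t = derivAt L t :=
  tendsto_nhds_unique (h.tendsto_derivAt ⟨ht.1.le, ht.2⟩)
    (EReal.tendsto_coe.2 ((h.continuousAt_derivAt ht).mono_left nhdsWithin_le_nhds))

theorem rightLim_le_derivAt (h : ConvexDiff L lam ε) {t s : ℝ} (ht : t ∈ Ico lam (lam + ε))
    (hts : t < s) (hs : s < lam + ε) : Function.rightLim (rightDeriv L) t ≤ derivAt L s := by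
  refine le_of_tendsto (h.tendsto_derivAt ht) ?_
  filter_upwards [Ioo_mem_nhdsGT hts] with u hu
  exact h.coe_monotoneOn ⟨ht.1.trans_lt hu.1, hu.2.trans hs⟩ ⟨ht.1.trans_lt hts, hs⟩ hu.2.le

theorem rightLim_ne_top (h : ConvexDiff L lam ε) {t : ℝ} (ht : t ∈ Ico lam (lam + ε)) :
    Function.rightLim (rightDeriv L) t ≠ ⊤ := by
  obtain ⟨s, hs⟩ := nonempty_Ioo.2 ht.2
  exact ((h.rightLim_le_derivAt ht hs.1 hs.2).trans_lt (EReal.coe_lt_top _)).ne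

theorem tendsto_leftLim (h : ConvexDiff L lam ε) :
    Tendsto (fun s => (derivAt L s : EReal)) (𝓝[<] (lam + ε))
      (𝓝 (Function.leftLim (leftDeriv L) (lam + ε))) := by
  have h1 : Tendsto (fun s => (derivAt L s : EReal)) (𝓝[<] (lam + ε))
      (𝓝 (sSup ((fun s => (derivAt L s : EReal)) '' Ioo lam (lam + ε)))) :=
    h.coe_monotoneOn.tendsto_nhdsWithin_Ioo_left (nonempty_Ioo.2 h.lt_add) (OrderTop.bddAbove _)
  have h2 : Tendsto (leftDeriv L) (𝓝[<] (lam + ε))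
      (𝓝 (sSup ((fun s => (derivAt L s : EReal)) '' Ioo lam (lam + ε)))) := by
    refine h1.congr' ?_
    filter_upwards [Ioo_mem_nhdsLT h.lt_add] with s hs using (h.leftDeriv_eq hs).symm
  rw [leftLim_eq_of_tendsto h2]
  exact h1

theorem derivAt_lt_leftLim (h : ConvexDiff L lam ε)
    (hsup : ¬ ∃ m, IsGreatest (derivAt L '' Ioo lam (lam + ε)) m) {t : ℝ}
    (ht : t ∈ Ioo lam (lam + ε)) :
    (derivAt L t : EReal) < Function.leftLim (leftDeriv L) (lam + ε) := by
  obtain ⟨s, hs, hts⟩ : ∃ s ∈ Ioo lam (lam + ε), derivAt L t < derivAt L s := by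
    by_contra! hcon
    exact hsup ⟨_, mem_image_of_mem _ ht, by rintro _ ⟨s, hs, rfl⟩; exact hcon s hs⟩
  refine (EReal.coe_lt_coe_iff.2 hts).trans_le (ge_of_tendsto h.tendsto_leftLim ?_)
  filter_upwards [Ioo_mem_nhdsLT hs.2] with u hu
  exact h.coe_monotoneOn hs ⟨hs.1.trans hu.1, hu.2⟩ hu.1.le

theorem exists_lt_derivAt (h : ConvexDiff L lam ε) {z : EReal}
    (hz : z < Function.leftLim (leftDeriv L) (lam + ε)) (t : ℝ) (ht : t < lam + ε) :
    ∃ s ∈ Ioo lam (lam + ε), t < s ∧ z < derivAt L s := by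
  obtain ⟨s, h1, h2, h3⟩ := ((h.tendsto_leftLim.eventually_const_lt hz).and
    (inter_mem (Ioo_mem_nhdsLT h.lt_add) (Ioo_mem_nhdsLT ht))).exists
  exact ⟨s, h2, h3.1, h1⟩

/-- Every value between the one-sided limits of the derivative is attained. -/
theorem exists_derivAt_eq (h : ConvexDiff L lam ε) {z : ℝ}
    (h1 : Function.rightLim (rightDeriv L) lam < z)
    (h2 : (z : EReal) < Function.leftLim (leftDeriv L) (lam + ε)) :
    ∃ t ∈ Ioo lam (lam + ε), derivAt L t = z := by
  have hl : lam ∈ Ico lam (lam + ε) := ⟨le_rfl, h.lt_add⟩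
  obtain ⟨s, hs, hsI⟩ := (((h.tendsto_derivAt hl).eventually_lt_const h1).and
    (Ioo_mem_nhdsGT_of_mem hl)).exists
  obtain ⟨u, hu, hsu, hu'⟩ := h.exists_lt_derivAt h2 s hsI.2
  rw [EReal.coe_lt_coe_iff] at hs hu'
  have hcont : ContinuousOn (derivAt L) (Icc s u) := fun r hr =>
    (h.continuousAt_derivAt ⟨hsI.1.trans_le hr.1, hr.2.trans_lt hu.2⟩).continuousWithinAt
  obtain ⟨t, ht, htz⟩ := intermediate_value_Icc hsu.le hcont ⟨hs.le, hu'.le⟩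
  exact ⟨t, ⟨hsI.1.trans_le ht.1, ht.2.trans_lt hu.2⟩, htz⟩

/-- `L` has a real right limit at every point of `[lam, lam + ε[`. -/
theorem exists_tendsto (h : ConvexDiff L lam ε) {t : ℝ} (ht : t ∈ Ico lam (lam + ε)) :
    ∃ l : ℝ, Function.rightLim L t = l ∧ Tendsto (fun s => (L s).toReal) (𝓝[>] t) (𝓝 l) := by
  obtain ⟨r, hr⟩ := nonempty_Ioo.2 ht.2
  have hrI : r ∈ Ioo lam (lam + ε) := ⟨ht.1.trans_lt hr.1, hr.2⟩
  have hsub : ∀ {s}, s ∈ Ioo t r → s ∈ Ioo lam (lam + ε) := fun hs =>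
    ⟨ht.1.trans_lt hs.1, hs.2.trans hr.2⟩
  have hr0 : 0 < r := h.nonneg.trans_lt hrI.1
  -- Subtracting the slope at `r` makes the function antitone on `]t, r[`, so only an upper bound is
  -- needed; the chord from the origin to `r` supplies it.
  set g : ℝ → ℝ := fun s => (L s).toReal - derivAt L r * s with hg
  have hanti : AntitoneOn g (Ioo t r) := by
    intro s hs u hu hsu
    have h1 := h.tangent_le_toReal (hsub hu) (hsub hs)
    have h2 := h.monotoneOn (hsub hu) hrI hu.2.le
    simp only [hg]
    nlinarith
  have hbdd : BddAbove (g '' Ioo t r) := by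
    refine ⟨|(L r).toReal| + |derivAt L r| * r, ?_⟩
    rintro _ ⟨s, hs, rfl⟩
    have hs0 : 0 < s := h.nonneg.trans_lt (hsub hs).1
    have hsr : s / r ≤ 1 := (div_le_one hr0).2 hs.2.le
    have hc := h.conv (sub_nonneg.2 hsr) (by positivity : 0 ≤ s / r) (sub_add_cancel 1 (s / r))
      (s := 0) (A := 0) (by simp [h.zero]) (h.coe_toReal hrI).ge
    rw [mul_zero, zero_add, div_mul_cancel₀ _ hr0.ne', ← h.coe_toReal (hsub hs),
      EReal.coe_le_coe_iff, zero_add] at hc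
    have h1 : s / r * (L r).toReal ≤ |(L r).toReal| := by
      calc s / r * (L r).toReal ≤ s / r * |(L r).toReal| := by gcongr; exact le_abs_self _
        _ ≤ 1 * |(L r).toReal| := by gcongr
        _ = _ := one_mul _
    have h2 : -(derivAt L r * s) ≤ |derivAt L r| * r := by
      calc -(derivAt L r * s) = (-derivAt L r) * s := by ring
        _ ≤ |derivAt L r| * s := by gcongr; exact neg_le_abs _
        _ ≤ _ := by gcongr; exact hs.2.le
    simp only [hg]
    linarith
  have hlim := hanti.tendsto_nhdsWithin_Ioo_right (nonempty_Ioo.2 hr.1) hbdd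
  have hf : Tendsto (fun s => (L s).toReal) (𝓝[>] t)
      (𝓝 (sSup (g '' Ioo t r) + derivAt L r * t)) := by
    have hid : Tendsto (fun s : ℝ => s) (𝓝[>] t) (𝓝 t) := nhdsWithin_le_nhds
    refine (hlim.add (hid.const_mul (derivAt L r))).congr fun s => ?_
    simp [hg]
  refine ⟨_, rightLim_eq_of_tendsto ((EReal.tendsto_coe.2 hf).congr' ?_), hf⟩
  filter_upwards [Ioo_mem_nhdsGT_of_mem ht] with s hs using h.coe_toReal hs

/-! ### The values `L(t⁺) - t z` -/

/-- Nonpositive intercepts mean that the slope at `s` is at least `L s / s`, which stays bounded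
below as `s ↓ t` when `t > 0`. -/
theorem eq_zero_of_rightLim_eq_bot (h : ConvexDiff L lam ε) {t : ℝ} (ht : t ∈ Ico lam (lam + ε))
    (hbot : Function.rightLim (rightDeriv L) t = ⊥) : t = 0 ∧ lam = 0 := by
  have htl : t = lam := by
    by_contra hne
    rw [h.rightLim_rightDeriv_eq ⟨lt_of_le_of_ne ht.1 (Ne.symm hne), ht.2⟩] at hbot
    exact EReal.coe_ne_bot _ hbot
  subst htl
  suffices ht0 : t = 0 from ⟨ht0, ht0⟩
  by_contra hne
  have hpos : 0 < t := lt_of_le_of_ne h.nonneg (Ne.symm hne)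
  obtain ⟨l, -, hl⟩ := h.exists_tendsto ht
  have hid : Tendsto (fun s : ℝ => s) (𝓝[>] t) (𝓝 t) := nhdsWithin_le_nhds
  have h1 : Tendsto (fun s => (((L s).toReal / s : ℝ) : EReal)) (𝓝[>] t) (𝓝 ((l / t : ℝ) : EReal)) :=
    EReal.tendsto_coe.2 (hl.div hid hne)
  have h2 := h.tendsto_derivAt ht
  rw [hbot] at h2
  have h3 : ((l / t : ℝ) : EReal) ≤ ⊥ := by
    refine le_of_tendsto_of_tendsto h1 h2 ?_
    filter_upwards [Ioo_mem_nhdsGT_of_mem ht] with s hs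
    rw [EReal.coe_le_coe_iff, div_le_iff₀ (hpos.trans hs.1)]
    have := h.intercept_le_zero hs
    unfold intercept at this
    linarith
  exact EReal.coe_ne_bot _ (le_bot_iff.1 h3)

/-- `L(t⁺) - t z` is the limit from the right of the intercepts of the tangents. -/
theorem exists_value_eq (h : ConvexDiff L lam ε)
    (hzero : lam = 0 → Function.rightLim (rightDeriv L) 0 = ⊥ → ContinuousWithinAt L (Ici 0) 0)
    {t : ℝ} (ht : t ∈ Ico lam (lam + ε)) {z : EReal}
    (hz : Function.rightLim (rightDeriv L) t = z) :
    ∃ v : ℝ, value L t z = v ∧ Tendsto (intercept L) (𝓝[>] t) (𝓝 v) ∧ (z = ⊥ → v = 0) := by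
  obtain ⟨l, hlL, hl⟩ := h.exists_tendsto ht
  have htop := h.rightLim_ne_top ht
  rw [hz] at htop
  have hlim := h.tendsto_derivAt ht
  rw [hz] at hlim
  by_cases hbot : z = ⊥
  · subst hbot
    obtain ⟨rfl, rfl⟩ := h.eq_zero_of_rightLim_eq_bot ht hz
    have hl0 : l = 0 := by
      have := (hzero rfl hz).rightLim_eq
      rw [hlL, h.zero] at this
      exact_mod_cast this
    subst hl0
    refine ⟨0, by simp [value, hlL], ?_, fun _ => rfl⟩
    -- Near `0` the slopes are negative, so the intercepts are squeezed between `L s`, which tends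
    -- to `0`, and `0`.
    refine tendsto_of_tendsto_of_tendsto_of_le_of_le' hl tendsto_const_nhds ?_ ?_
    · filter_upwards [hlim.eventually_lt_const (EReal.bot_lt_coe 0), self_mem_nhdsWithin] with s hs hs0
      rw [EReal.coe_lt_coe_iff] at hs
      have hs0' : (0 : ℝ) < s := hs0
      unfold intercept
      nlinarith
    · filter_upwards [Ioo_mem_nhdsGT_of_mem ht] with s hs using h.intercept_le_zero hs
  · lift z to ℝ using ⟨htop, hbot⟩
    refine ⟨l - t * z, ?_, ?_, fun hb => absurd hb (EReal.coe_ne_bot z)⟩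
    · rw [value, hlL]
      norm_cast
    · have hid : Tendsto (fun s : ℝ => s) (𝓝[>] t) (𝓝 t) := nhdsWithin_le_nhds
      exact hl.sub (hid.mul (EReal.tendsto_coe.1 hlim))

/-- `z` is a slope of a supporting line. -/
theorem add_le_of_value_eq (h : ConvexDiff L lam ε)
    (hzero : lam = 0 → Function.rightLim (rightDeriv L) 0 = ⊥ → ContinuousWithinAt L (Ici 0) 0)
    {t z v : ℝ} (ht : t ∈ Ico lam (lam + ε))
    (hz : Function.rightLim (rightDeriv L) t = z) (hv : value L t z = v) (s : ℝ) :
    ((v + s * z : ℝ) : EReal) ≤ L s := by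
  obtain ⟨v', hv', hlim, -⟩ := h.exists_value_eq hzero ht hz
  obtain rfl : v = v' := by
    rw [hv] at hv'
    exact_mod_cast hv'
  have hD := h.tendsto_derivAt ht
  rw [hz, EReal.tendsto_coe] at hD
  refine le_of_tendsto (EReal.tendsto_coe.2 (hlim.add (hD.const_mul s))) ?_
  filter_upwards [Ioo_mem_nhdsGT_of_mem ht] with u hu
  refine le_of_eq_of_le ?_ (h.tangent_le hu s)
  rw [intercept]
  congr 1
  ring

theorem tendsto_sub_mul (h : ConvexDiff L lam ε)
    {t z v : ℝ} (ht : t ∈ Ico lam (lam + ε)) (hv : value L t z = v) :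
    Tendsto (fun s => (L s).toReal - s * z) (𝓝[>] t) (𝓝 v) := by
  obtain ⟨l, hlL, hl⟩ := h.exists_tendsto ht
  have hid : Tendsto (fun s : ℝ => s) (𝓝[>] t) (𝓝 t) := nhdsWithin_le_nhds
  have : v = l - t * z := by
    rw [value, hlL] at hv
    exact_mod_cast hv.symm
  rw [this]
  exact hl.sub (hid.mul_const z)

/-- The supporting line of slope `z` gives one inequality, and points `s ↓ t` approach equality. The
right side does not involve `t`, which later yields independence of the choice of `t`. -/
theorem value_eq_iInf (h : ConvexDiff L lam ε)
    (hzero : lam = 0 → Function.rightLim (rightDeriv L) 0 = ⊥ → ContinuousWithinAt L (Ici 0) 0)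
    {t z : ℝ} (ht : t ∈ Ico lam (lam + ε)) (hz : Function.rightLim (rightDeriv L) t = z) :
    value L t z = ⨅ s : Ioi (0 : ℝ), (L s - ((s : ℝ) : EReal) * z) := by
  obtain ⟨v, hv, -⟩ := h.exists_value_eq hzero ht hz
  rw [hv]
  refine le_antisymm (le_iInf fun s => ?_) ?_
  · have := h.add_le_of_value_eq hzero ht hz hv s
    rw [← EReal.coe_mul]
    refine EReal.le_sub_iff_add_le (.inl (EReal.coe_ne_bot _)) (.inl (EReal.coe_ne_top _)) |>.2 ?_
    exact_mod_cast this
  · refine ge_of_tendsto (EReal.tendsto_coe.2 (h.tendsto_sub_mul ht hv)) ?_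
    filter_upwards [Ioo_mem_nhdsGT_of_mem ht] with s hs
    refine (iInf_le _ (⟨s, h.nonneg.trans_lt hs.1⟩ : Ioi (0 : ℝ))).trans_eq ?_
    rw [EReal.coe_sub, h.coe_toReal hs, EReal.coe_mul]

theorem value_eq_neg_legendre (h : ConvexDiff L lam ε)
    (hzero : lam = 0 → Function.rightLim (rightDeriv L) 0 = ⊥ → ContinuousWithinAt L (Ici 0) 0)
    {t z : ℝ} (ht : t ∈ Ico lam (lam + ε)) (hz : Function.rightLim (rightDeriv L) t = z) :
    value L t z = -legendre L z := by
  obtain ⟨v, hv, -⟩ := h.exists_value_eq hzero ht hz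
  rw [hv, legendre, if_neg (EReal.coe_ne_bot z), ← neg_eq_iff_eq_neg, ← EReal.coe_neg]
  refine le_antisymm ?_ (iSup_le fun s => ?_)
  · refine le_of_tendsto (EReal.tendsto_coe.2 (h.tendsto_sub_mul ht hv).neg) ?_
    filter_upwards [Ioo_mem_nhdsGT_of_mem ht] with s hs
    refine le_of_eq_of_le ?_ (le_iSup _ s)
    rw [neg_sub, EReal.coe_sub, h.coe_toReal hs, EReal.coe_mul]
  · have := h.add_le_of_value_eq hzero ht hz hv s
    rw [← EReal.coe_mul]
    refine EReal.sub_le_of_le_add ?_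
    calc ((s * z : ℝ) : EReal) = ((-v : ℝ) : EReal) + ((v + s * z : ℝ) : EReal) := by
          norm_cast; ring
      _ ≤ _ := by gcongr

theorem value_le_zero (h : ConvexDiff L lam ε)
    (hzero : lam = 0 → Function.rightLim (rightDeriv L) 0 = ⊥ → ContinuousWithinAt L (Ici 0) 0)
    {t : ℝ} (ht : t ∈ Ico lam (lam + ε)) {z : EReal}
    (hz : Function.rightLim (rightDeriv L) t = z) : value L t z ≤ 0 := by
  obtain ⟨v, hv, hlim, -⟩ := h.exists_value_eq hzero ht hz
  rw [hv, EReal.coe_nonpos]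
  refine le_of_tendsto hlim ?_
  filter_upwards [Ioo_mem_nhdsGT_of_mem ht] with s hs using h.intercept_le_zero hs

/-- The Legendre-Fenchel transform vanishes at `-∞` when the right derivative at `0` is `-∞`. -/
theorem tendsto_legendre_bot (h : ConvexDiff L lam ε)
    (hzero : lam = 0 → Function.rightLim (rightDeriv L) 0 = ⊥ → ContinuousWithinAt L (Ici 0) 0)
    {t : ℝ} (ht : t ∈ Ico lam (lam + ε)) (hz : Function.rightLim (rightDeriv L) t = ⊥) :
    Tendsto (legendre L) (𝓝 ⊥) (𝓝 0) := by
  obtain ⟨v, hv, hlim, hv0⟩ := h.exists_value_eq hzero ht hz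
  obtain ⟨rfl, rfl⟩ := h.eq_zero_of_rightLim_eq_bot ht hz
  obtain rfl := hv0 rfl
  have hL0 : Function.rightLim L 0 = 0 := by rw [(hzero rfl hz).rightLim_eq, h.zero]
  have hD := h.tendsto_derivAt ht
  rw [hz] at hD
  -- Tangents at `u ↓ 0` have slope tending to `-∞` and intercept above `-1`, so at a negative `s`
  -- they exceed any bound. Only `s ≥ 0` then matters in the Legendre transform.
  have hneg : ∀ s < 0, L s = ⊤ := by
    intro s hs
    refine EReal.eq_top_iff_forall_lt _ |>.2 fun M => ?_
    have h1 : ∀ᶠ u in 𝓝[>] (0 : ℝ), -1 < intercept L u := hlim.eventually_const_lt (by norm_num)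
    have h2 := hD.eventually_lt_const (EReal.bot_lt_coe ((M + 1) / s))
    obtain ⟨u, hu1, hu2, hu⟩ := (h1.and (h2.and (Ioo_mem_nhdsGT_of_mem ht))).exists
    refine lt_of_lt_of_le ?_ (h.tangent_le hu s)
    rw [EReal.coe_lt_coe_iff] at hu2 ⊢
    rw [lt_div_iff_of_neg hs] at hu2
    rw [intercept] at hu1
    linarith
  have hnonneg : ∀ᶠ x in 𝓝 (⊥ : EReal), 0 ≤ legendre L x := by
    filter_upwards [Iio_mem_nhds (EReal.bot_lt_coe 0)] with x hx
    by_cases hxb : x = ⊥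
    · simp [legendre, hxb, hL0]
    · rw [legendre, if_neg hxb]
      refine le_of_eq_of_le ?_ (le_iSup _ 0)
      simp [h.zero]
  refine tendsto_order.2 ⟨fun m hm => hnonneg.mono fun x hx => hm.trans_le hx, fun m hm => ?_⟩
  have h1 : ∀ᶠ u in 𝓝[>] (0 : ℝ), ((-intercept L u : ℝ) : EReal) < m := by
    refine (EReal.tendsto_coe.2 hlim.neg).eventually_lt_const ?_
    simpa using hm
  obtain ⟨u, hum, hu⟩ := (h1.and (Ioo_mem_nhdsGT_of_mem ht)).exists
  filter_upwards [Iio_mem_nhds (EReal.bot_lt_coe (derivAt L u))] with x hx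
  have hxD : x < derivAt L u := hx
  by_cases hxb : x = ⊥
  · simpa [legendre, hxb, hL0] using hm
  · lift x to ℝ using ⟨(hxD.trans (EReal.coe_lt_top _)).ne, hxb⟩
    rw [EReal.coe_lt_coe_iff] at hxD
    refine lt_of_le_of_lt ?_ hum
    rw [legendre, if_neg hxb]
    refine iSup_le fun s => ?_
    rcases lt_or_ge s 0 with hs | hs
    · rw [hneg s hs, ← EReal.coe_mul, EReal.sub_top]
      exact bot_le
    · rw [← EReal.coe_mul]
      refine EReal.sub_le_of_le_add ?_
      calc ((s * x : ℝ) : EReal) ≤ ((-intercept L u : ℝ) : EReal) +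
            (((L u).toReal + derivAt L u * (s - u) : ℝ) : EReal) := by
            rw [← EReal.coe_add, EReal.coe_le_coe_iff, intercept]
            nlinarith
        _ ≤ _ := by gcongr; exact h.tangent_le hu s

/-! ### The end of the affine part -/

theorem toReal_eq_of_derivAt_eq (h : ConvexDiff L lam ε) {u s : ℝ} (hu : u ∈ Ioo lam (lam + ε))
    (hs : s ∈ Ioo lam (lam + ε)) (hus : derivAt L u = derivAt L s) :
    (L u).toReal = (L s).toReal + derivAt L s * (u - s) := by
  have h1 := h.tangent_le_toReal hu hs
  have h2 := h.tangent_le_toReal hs hu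
  rw [hus] at h1
  linarith

/-- Affinity means a constant derivative; by monotonicity this only has to be tested at the two
ends. This translates `affineEnd` into information on slopes. -/
theorem affineOn_iff (h : ConvexDiff L lam ε) {t s : ℝ} (ht : t ∈ Ico lam (lam + ε)) (hts : t < s)
    (hs : s < lam + ε) :
    AffineOn L (Ioc t s) ↔ (derivAt L s : EReal) = Function.rightLim (rightDeriv L) t := by
  have hsI : s ∈ Ioo lam (lam + ε) := ⟨ht.1.trans_lt hts, hs⟩
  have hsub : ∀ {u}, u ∈ Ioc t s → u ∈ Ioo lam (lam + ε) := fun hu =>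
    ⟨ht.1.trans_lt hu.1, hu.2.trans_lt hs⟩
  constructor
  · rintro ⟨p, q, hpq⟩
    have hD : ∀ u ∈ Ioo t s, derivAt L u = p := by
      intro u hu
      have : (fun v => (L v).toReal) =ᶠ[𝓝 u] fun v => p * v + q := by
        filter_upwards [Ioo_mem_nhds hu.1 hu.2] with v hv
        rw [hpq v ⟨hv.1, hv.2.le⟩, EReal.toReal_coe]
      rw [derivAt, this.deriv_eq]
      simp
    have h1 : Function.rightLim (rightDeriv L) t = p := by
      refine tendsto_nhds_unique (h.tendsto_derivAt ht) (tendsto_const_nhds.congr' ?_)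
      filter_upwards [Ioo_mem_nhdsGT hts] with u hu
      rw [hD u hu]
    have h2 : derivAt L s = p := by
      have hc : Tendsto (derivAt L) (𝓝[<] s) (𝓝 (derivAt L s)) :=
        (h.continuousAt_derivAt hsI).mono_left nhdsWithin_le_nhds
      refine tendsto_nhds_unique hc (tendsto_const_nhds.congr' ?_)
      filter_upwards [Ioo_mem_nhdsLT hts] with u hu
      rw [hD u hu]
    rw [h1, h2]
  · intro heq
    refine ⟨derivAt L s, (L s).toReal - derivAt L s * s, fun u hu => ?_⟩
    have hus : derivAt L u = derivAt L s := by
      refine le_antisymm (h.monotoneOn (hsub hu) hsI hu.2) ?_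
      rw [← EReal.coe_le_coe_iff, heq]
      exact h.rightLim_le_derivAt ht hu.1 (hsub hu).2
    rw [← h.coe_toReal (hsub hu), h.toReal_eq_of_derivAt_eq (hsub hu) hsI hus]
    congr 1
    ring

theorem _root_.PlachkySteinebach.AffineOn.mono {L : ℝ → EReal} {S T : Set ℝ} (h : AffineOn L T)
    (hST : S ⊆ T) : AffineOn L S := by
  obtain ⟨p, q, hpq⟩ := h
  exact ⟨p, q, fun s hs => hpq s (hST hs)⟩

theorem mem_affine_set (L : ℝ → EReal) (t : ℝ) : t ∈ {s | t ≤ s ∧ AffineOn L (Ioc t s)} :=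
  ⟨le_rfl, 0, 0, by simp⟩

section AffineEnd

variable {t : ℝ}

theorem bddAbove_affine_set (h : ConvexDiff L lam ε) (ht : t ∈ Ico lam (lam + ε))
    {u : ℝ} (htu : t < u) (hu : u < lam + ε)
    (hz : Function.rightLim (rightDeriv L) t < derivAt L u) :
    u ∈ upperBounds {s | t ≤ s ∧ AffineOn L (Ioc t s)} := by
  rintro r ⟨-, hr⟩
  by_contra! hur
  exact hz.ne' ((h.affineOn_iff ht htu hu).1 (hr.mono (Ioc_subset_Ioc_right hur.le)))

/-- The strict inequality `hb` yields a point of larger slope before `lam + ε`, which bounds the set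
in `affineEnd` and leaves room to its right for tilting. -/
theorem affineEnd_mem (h : ConvexDiff L lam ε) (ht : t ∈ Ico lam (lam + ε))
    (hb : Function.rightLim (rightDeriv L) t < Function.leftLim (leftDeriv L) (lam + ε)) :
    affineEnd L t ∈ Ico t (lam + ε) := by
  obtain ⟨u, hu, htu, hzu⟩ := h.exists_lt_derivAt hb t ht.2
  have hub := h.bddAbove_affine_set ht htu hu.2 hzu
  exact ⟨le_csSup ⟨_, hub⟩ (mem_affine_set L t),
    (csSup_le ⟨t, mem_affine_set L t⟩ hub).trans_lt hu.2⟩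

theorem rightLim_lt_derivAt (h : ConvexDiff L lam ε) (ht : t ∈ Ico lam (lam + ε))
    (hb : Function.rightLim (rightDeriv L) t < Function.leftLim (leftDeriv L) (lam + ε)) {s : ℝ}
    (hs : s ∈ Ioo (affineEnd L t) (lam + ε)) :
    Function.rightLim (rightDeriv L) t < derivAt L s := by
  have he := h.affineEnd_mem ht hb
  obtain ⟨u, hu, htu, hzu⟩ := h.exists_lt_derivAt hb t ht.2
  have hts : t < s := he.1.trans_lt hs.1
  refine lt_of_le_of_ne (h.rightLim_le_derivAt ht hts hs.2) fun heq => ?_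
  have := (h.affineOn_iff ht hts hs.2).2 heq.symm
  exact hs.1.not_ge (le_csSup ⟨_, h.bddAbove_affine_set ht htu hu.2 hzu⟩ ⟨hts.le, this⟩)

theorem derivAt_eq_rightLim (h : ConvexDiff L lam ε) (ht : t ∈ Ico lam (lam + ε))
    (hb : Function.rightLim (rightDeriv L) t < Function.leftLim (leftDeriv L) (lam + ε)) {s : ℝ}
    (hs : s ∈ Ioc t (affineEnd L t)) :
    (derivAt L s : EReal) = Function.rightLim (rightDeriv L) t := by
  have he := h.affineEnd_mem ht hb
  have key : ∀ u ∈ Ioo t (affineEnd L t),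
      (derivAt L u : EReal) = Function.rightLim (rightDeriv L) t := by
    intro u hu
    obtain ⟨r, ⟨-, hr⟩, hur⟩ := exists_lt_of_lt_csSup ⟨t, mem_affine_set L t⟩ hu.2
    exact (h.affineOn_iff ht hu.1 (hu.2.trans he.2)).1 (hr.mono (Ioc_subset_Ioc_right hur.le))
  have hc : Tendsto (fun u => (derivAt L u : EReal)) (𝓝[<] s) (𝓝 (derivAt L s)) :=
    EReal.tendsto_coe.2 ((h.continuousAt_derivAt
      ⟨ht.1.trans_lt hs.1, hs.2.trans_lt he.2⟩).mono_left nhdsWithin_le_nhds)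
  refine tendsto_nhds_unique hc (tendsto_const_nhds.congr' ?_)
  filter_upwards [Ioo_mem_nhdsLT hs.1] with u hu
  exact (key u ⟨hu.1, hu.2.trans_le hs.2⟩).symm

theorem tendsto_derivAt_affineEnd (h : ConvexDiff L lam ε) (ht : t ∈ Ico lam (lam + ε))
    (hb : Function.rightLim (rightDeriv L) t < Function.leftLim (leftDeriv L) (lam + ε)) :
    Tendsto (fun s => (derivAt L s : EReal)) (𝓝[>] (affineEnd L t))
      (𝓝 (Function.rightLim (rightDeriv L) t)) := by
  have he := h.affineEnd_mem ht hb
  rcases he.1.eq_or_lt with heq | hlt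
  · rw [← heq]
    exact h.tendsto_derivAt ht
  · rw [← h.derivAt_eq_rightLim ht hb ⟨hlt, le_rfl⟩]
    exact EReal.tendsto_coe.2 ((h.continuousAt_derivAt
      ⟨ht.1.trans_lt hlt, he.2⟩).mono_left nhdsWithin_le_nhds)

/-- Along an affine piece all tangents coincide, so the intercept does not change between `t` and
the end of the piece. -/
theorem tendsto_intercept_affineEnd (h : ConvexDiff L lam ε) (ht : t ∈ Ico lam (lam + ε))
    (hb : Function.rightLim (rightDeriv L) t < Function.leftLim (leftDeriv L) (lam + ε)) {v : ℝ}
    (hv : Tendsto (intercept L) (𝓝[>] t) (𝓝 v)) :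
    Tendsto (intercept L) (𝓝[>] (affineEnd L t)) (𝓝 v) := by
  have he := h.affineEnd_mem ht hb
  rcases he.1.eq_or_lt with heq | hlt
  · rwa [← heq]
  · have heI : affineEnd L t ∈ Ioo lam (lam + ε) := ⟨ht.1.trans_lt hlt, he.2⟩
    have hve : v = intercept L (affineEnd L t) := by
      refine tendsto_nhds_unique hv (tendsto_const_nhds.congr' ?_)
      filter_upwards [Ioo_mem_nhdsGT hlt] with u hu
      have hD : derivAt L u = derivAt L (affineEnd L t) := by
        rw [← EReal.coe_eq_coe_iff, h.derivAt_eq_rightLim ht hb ⟨hu.1, hu.2.le⟩,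
          h.derivAt_eq_rightLim ht hb ⟨hlt, le_rfl⟩]
      have := h.toReal_eq_of_derivAt_eq ⟨ht.1.trans_lt hu.1, hu.2.trans he.2⟩ heI hD
      rw [intercept, intercept, this, hD]
      ring
    rw [hve]
    exact (h.continuousAt_intercept heI).mono_left nhdsWithin_le_nhds

end AffineEnd

end ConvexDiff

namespace ConvexDiff

/-! ### Large deviation bounds -/

section Net

variable {ι : Type*} [Preorder ι] {μ : ι → Measure ℝ} {c : ι → ℝ} {lam ε : ℝ}

theorem exists_eventually_lt_logOpen (h : ConvexDiff (upperLMGF μ c) lam ε)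
    (hc : ∀ α, 0 < c α) (hc0 : Tendsto c atTop (𝓝 0)) {s A : ℝ} (hs : s ∈ Ioo lam (lam + ε))
    {x y : ι → EReal} {z : EReal} (hx : Tendsto x atTop (𝓝 z))
    (hzs : z < derivAt (upperLMGF μ c) s) (hsy : derivAt (upperLMGF μ c) s < liminf y atTop)
    (hA : A < intercept (upperLMGF μ c) s) :
    ∃ B : EReal, B < upperLMGF μ c s ∧ ∀ᶠ α in atTop, B < logMoment (μ α) (c α) s →
      (A : EReal) < logOpen (μ α) (c α) (x α) (y α) := by
  set L := upperLMGF μ c with hL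
  have hs0 : 0 < s := h.nonneg.trans_lt hs.1
  obtain ⟨y', hy', hyy'⟩ := EReal.lt_iff_exists_real_btwn.1 hsy
  obtain ⟨l, hzl, hl⟩ := EReal.lt_iff_exists_real_btwn.1 hzs
  rw [EReal.coe_lt_coe_iff] at hl hy'
  have hA' : derivAt L s < ((L s).toReal - A) / s := by
    rw [intercept] at hA
    rw [lt_div_iff₀ hs0]
    linarith
  -- `r` lies just above the slope at `s`: below the lower limit of `y`, and close enough that `A +
  -- s * r` stays below `L s`. The secants to the points `v` and `u` found next give the two moment
  -- bounds.
  obtain ⟨r, hDr, hr⟩ := exists_between (lt_min hy' hA')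
  have hry : (r : EReal) < liminf y atTop :=
    (EReal.coe_lt_coe_iff.2 (hr.trans_le (min_le_left _ _))).trans hyy'
  have hAr : A + s * r < (L s).toReal := by
    have := hr.trans_le (min_le_right _ _)
    rw [lt_div_iff₀ hs0] at this
    linarith
  have hslope := (h.hasDerivAt hs).tendsto_slope
  have hI : Ioo lam (lam + ε) ∈ 𝓝 s := Ioo_mem_nhds hs.1 hs.2
  have h1 : ∀ᶠ v in 𝓝[>] s, slope (fun s => (L s).toReal) s v < r :=
    (hslope.mono_left (nhdsWithin_mono _ fun v hv => ne_of_gt hv)).eventually_lt_const hDr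
  obtain ⟨v, hv, hvI, hvs⟩ := (h1.and (inter_mem (mem_nhdsWithin_of_mem_nhds hI)
    self_mem_nhdsWithin)).exists
  have hvs' : s < v := hvs
  have h2 : ∀ᶠ v in 𝓝[<] s, l < slope (fun s => (L s).toReal) s v :=
    (hslope.mono_left (nhdsWithin_mono _ fun v hv => ne_of_lt hv)).eventually_const_lt hl
  obtain ⟨u, hu, huI, hus⟩ := (h2.and (inter_mem (mem_nhdsWithin_of_mem_nhds hI)
    self_mem_nhdsWithin)).exists
  have hus' : u < s := hus
  rw [slope_def_field, div_lt_iff₀ (by linarith)] at hv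
  rw [slope_comm, slope_def_field, lt_div_iff₀ (by linarith)] at hu
  obtain ⟨B, hB, hev⟩ := PlachkySteinebach.exists_eventually_lt_logOpen (F := (L s).toReal)
    (l := l) (r := r) (h₁ := v - s) (h₂ := s - u) hc hc0 hs0 (by linarith) (by linarith)
    (by
      rw [add_sub_cancel, ← hL, ← h.coe_toReal hvI, EReal.coe_lt_coe_iff]
      linarith)
    (by
      rw [sub_sub_cancel, ← hL, ← h.coe_toReal huI, EReal.coe_lt_coe_iff]
      linarith)
    hAr ((hx.eventually_lt_const hzl).mono fun _ h => h.le)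
    ((eventually_lt_of_lt_liminf hry).mono fun _ h => h.le)
  refine ⟨B, ?_, hev⟩
  rwa [← h.coe_toReal hs, EReal.coe_lt_coe_iff]

theorem limsup_logClosed_le (h : ConvexDiff (upperLMGF μ c) lam ε)
    (hμ : ∀ α, IsProbabilityMeasure (μ α)) (hc : ∀ α, 0 < c α)
    (hzero : lam = 0 → Function.rightLim (rightDeriv (upperLMGF μ c)) 0 = ⊥ →
      ContinuousWithinAt (upperLMGF μ c) (Ici 0) 0)
    {t : ℝ} (ht : t ∈ Ico lam (lam + ε)) {z : EReal}
    (hz : Function.rightLim (rightDeriv (upperLMGF μ c)) t = z) {x : ι → EReal} (y : ι → EReal)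
    (hx : Tendsto x atTop (𝓝 z)) :
    limsup (fun α => logClosed (μ α) (c α) (x α) (y α)) atTop ≤ value (upperLMGF μ c) t z := by
  obtain ⟨v, hv, -, hv0⟩ := h.exists_value_eq hzero ht hz
  by_cases hbot : z = ⊥
  · rw [hv, hv0 hbot]
    exact limsup_le_of_le (h := Eventually.of_forall fun α =>
      have := hμ α; logClosed_le_zero (hc α) _ _)
  · lift z to ℝ using ⟨hz ▸ h.rightLim_ne_top ht, hbot⟩
    rw [hv]
    have hlim := h.tendsto_sub_mul ht hv
    refine EReal.le_of_forall_lt_iff_le.1 fun M hM => ?_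
    rw [EReal.coe_lt_coe_iff] at hM
    obtain ⟨s, hsM, hs⟩ := ((hlim.eventually_lt_const hM).and
      (Ioo_mem_nhdsGT_of_mem ht)).exists
    have hs0 : 0 < s := h.nonneg.trans_lt hs.1
    set L := upperLMGF μ c with hL
    -- Half of the slack is spent on the strict bound for the moment, half on replacing `z` by `z -
    -- η / s`.
    set η := (M - ((L s).toReal - s * z)) / 2 with hη
    have hη0 : 0 < η := by rw [hη]; linarith
    have hw : (z - η / s : ℝ) < z := by
      have := div_pos hη0 hs0
      linarith
    refine (PlachkySteinebach.limsup_logClosed_le (K := (L s).toReal + η) (v := z - η / s) hc hs0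
      ?_ ?_).trans ?_
    · rw [← hL, ← h.coe_toReal hs, EReal.coe_lt_coe_iff, EReal.toReal_coe]
      linarith
    · exact (hx.eventually_const_lt (EReal.coe_lt_coe_iff.2 hw)).mono fun _ h => h.le
    · rw [EReal.coe_le_coe_iff, mul_sub, mul_div_cancel₀ _ hs0.ne']
      linarith

theorem le_limsup_logOpen (h : ConvexDiff (upperLMGF μ c) lam ε)
    (hc : ∀ α, 0 < c α) (hc0 : Tendsto c atTop (𝓝 0))
    (hzero : lam = 0 → Function.rightLim (rightDeriv (upperLMGF μ c)) 0 = ⊥ →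
      ContinuousWithinAt (upperLMGF μ c) (Ici 0) 0)
    {t : ℝ} (ht : t ∈ Ico lam (lam + ε)) {z : EReal}
    (hz : Function.rightLim (rightDeriv (upperLMGF μ c)) t = z)
    (hzb : z < Function.leftLim (leftDeriv (upperLMGF μ c)) (lam + ε)) {x y : ι → EReal}
    (hx : Tendsto x atTop (𝓝 z)) (hy : z < liminf y atTop) :
    value (upperLMGF μ c) t z ≤ limsup (fun α => logOpen (μ α) (c α) (x α) (y α)) atTop := by
  obtain ⟨v, hv, hlim, -⟩ := h.exists_value_eq hzero ht hz
  subst hz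
  rw [hv]
  refine EReal.ge_of_forall_gt_iff_ge.1 fun A hA => ?_
  rw [EReal.coe_lt_coe_iff] at hA
  have he := h.affineEnd_mem ht hzb
  obtain ⟨s, ⟨hsA, hsy⟩, hs⟩ := ((((h.tendsto_intercept_affineEnd ht hzb hlim).eventually_const_lt
    hA).and ((h.tendsto_derivAt_affineEnd ht hzb).eventually_lt_const hy)).and
      (Ioo_mem_nhdsGT he.2)).exists
  obtain ⟨B, hB, hev⟩ := h.exists_eventually_lt_logOpen hc hc0
    ⟨(ht.1.trans he.1).trans_lt hs.1, hs.2⟩ hx (h.rightLim_lt_derivAt ht hzb hs) hsy hsA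
  -- An upper limit makes the moment at `s` large only frequently, which is enough for an upper
  -- limit of the masses.
  refine le_limsup_of_frequently_le' ?_
  have hfreq : ∃ᶠ α in atTop, B < logMoment (μ α) (c α) s := frequently_lt_of_lt_limsup (h := hB)
  exact (hfreq.and_eventually hev).mono fun α hα => (hα.2 hα.1).le

theorem le_liminf_logOpen (h : ConvexDiff (upperLMGF μ c) lam ε)
    (hc : ∀ α, 0 < c α) (hc0 : Tendsto c atTop (𝓝 0))
    (hzero : lam = 0 → Function.rightLim (rightDeriv (upperLMGF μ c)) 0 = ⊥ →
      ContinuousWithinAt (upperLMGF μ c) (Ici 0) 0)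
    {t : ℝ} (ht : t ∈ Ico lam (lam + ε)) {z : EReal}
    (hz : Function.rightLim (rightDeriv (upperLMGF μ c)) t = z)
    (hzb : z < Function.leftLim (leftDeriv (upperLMGF μ c)) (lam + ε)) {x y : ι → EReal}
    (hx : Tendsto x atTop (𝓝 z)) (hy : z < liminf y atTop) {u : ℕ → ℝ}
    (hu : ∀ i, affineEnd (upperLMGF μ c) t < u i)
    (hulim : Tendsto u atTop (𝓝 (affineEnd (upperLMGF μ c) t)))
    (hex : ∀ i, LMGFExists μ c (u i)) :
    value (upperLMGF μ c) t z ≤ liminf (fun α => logOpen (μ α) (c α) (x α) (y α)) atTop := by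
  obtain ⟨v, hv, hlim, -⟩ := h.exists_value_eq hzero ht hz
  subst hz
  rw [hv]
  refine EReal.ge_of_forall_gt_iff_ge.1 fun A hA => ?_
  rw [EReal.coe_lt_coe_iff] at hA
  have he := h.affineEnd_mem ht hzb
  have hu' : Tendsto u atTop (𝓝[>] (affineEnd (upperLMGF μ c) t)) :=
    tendsto_nhdsWithin_iff.2 ⟨hulim, Eventually.of_forall hu⟩
  obtain ⟨i, ⟨hsA, hsy⟩, hs⟩ := (hu'.eventually (((
    (h.tendsto_intercept_affineEnd ht hzb hlim).eventually_const_lt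
    hA).and ((h.tendsto_derivAt_affineEnd ht hzb).eventually_lt_const hy)).and
      (Ioo_mem_nhdsGT he.2))).exists
  obtain ⟨B, hB, hev⟩ := h.exists_eventually_lt_logOpen hc hc0
    ⟨(ht.1.trans he.1).trans_lt hs.1, hs.2⟩ hx (h.rightLim_lt_derivAt ht hzb hs) hsy hsA
  refine le_liminf_of_le (h := ?_)
  filter_upwards [hev, (hex i).eventually_const_lt hB] with α h1 h2 using (h1 h2).le

end Net

/-! ### The rate as a function of `z` -/

variable {L : ℝ → EReal} {lam ε : ℝ}

theorem value_derivAt (h : ConvexDiff L lam ε) {u : ℝ} (hu : u ∈ Ioo lam (lam + ε)) :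
    value L u (derivAt L u) = intercept L u := by
  obtain ⟨l, hlL, hl⟩ := h.exists_tendsto (Ioo_subset_Ico_self hu)
  have : l = (L u).toReal :=
    tendsto_nhds_unique hl ((h.continuousAt hu).mono_left nhdsWithin_le_nhds)
  rw [value, hlL, this, intercept]
  norm_cast

end ConvexDiff

/-- The assumptions of the results on the rate function: `τ` chooses, for every `z ∈ [a, b[`, a
point of `[lam, lam + ε[` at which `z` is the right limit of the derivative. -/
structure RateData (L : ℝ → EReal) (lam ε : ℝ) (a b : EReal) (τ : EReal → ℝ) : Prop extends
    ConvexDiff L lam ε where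
  cont_zero : lam = 0 → Function.rightLim (rightDeriv L) 0 = ⊥ → ContinuousWithinAt L (Ici 0) 0
  left_eq : a = Function.rightLim (rightDeriv L) lam
  right_eq : b = Function.leftLim (leftDeriv L) (lam + ε)
  not_max : ¬ ∃ m, IsGreatest (derivAt L '' Ioo lam (lam + ε)) m
  mem : ∀ z ∈ Ico a b, τ z ∈ Ico lam (lam + ε)
  rightLim_eq : ∀ z ∈ Ico a b, Function.rightLim (rightDeriv L) (τ z) = z

namespace RateData

variable {L : ℝ → EReal} {lam ε : ℝ} {a b : EReal} {τ : EReal → ℝ}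

/-- The real value of the rate at a real point. -/
def _root_.PlachkySteinebach.rate (L : ℝ → EReal) (τ : EReal → ℝ) (z : EReal) : ℝ :=
  (value L (τ z) z).toReal

theorem coe_rate (h : RateData L lam ε a b τ) {z : EReal} (hz : z ∈ Ico a b) :
    (rate L τ z : EReal) = value L (τ z) z := by
  obtain ⟨v, hv, -⟩ := h.exists_value_eq h.cont_zero (h.mem z hz) (h.rightLim_eq z hz)
  rw [rate, hv, EReal.toReal_coe]

theorem rate_add_le (h : RateData L lam ε a b τ) {z : ℝ} (hz : (z : EReal) ∈ Ico a b) (s : ℝ) :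
    ((rate L τ z + s * z : ℝ) : EReal) ≤ L s :=
  h.add_le_of_value_eq h.cont_zero (h.mem z hz) (h.rightLim_eq z hz) (h.coe_rate hz).symm s

/-- The supporting line of slope `w`, evaluated at `s ↓ τ z`: thus `-τ z` is a supergradient at `z`.
-/
theorem rate_le (h : RateData L lam ε a b τ) {z w : ℝ} (hz : (z : EReal) ∈ Ico a b)
    (hw : (w : EReal) ∈ Ico a b) : rate L τ w ≤ rate L τ z + τ z * (z - w) := by
  have hid : Tendsto (fun s : ℝ => s) (𝓝[>] (τ z)) (𝓝 (τ z)) := nhdsWithin_le_nhds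
  refine ge_of_tendsto ((h.tendsto_sub_mul (h.mem z hz) (h.coe_rate hz).symm).add
    (hid.mul_const (z - w))) ?_
  filter_upwards [Ioo_mem_nhdsGT_of_mem (h.mem z hz)] with s hs
  have := h.rate_add_le hw s
  rw [← h.coe_toReal hs, EReal.coe_le_coe_iff] at this
  linarith

theorem mem_Ioo (h : RateData L lam ε a b τ) {z : EReal} (hz : z ∈ Ioo a b) :
    τ z ∈ Ioo lam (lam + ε) := by
  have hm := h.mem z ⟨hz.1.le, hz.2⟩
  refine ⟨lt_of_le_of_ne hm.1 fun heq => ?_, hm.2⟩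
  have := h.rightLim_eq z ⟨hz.1.le, hz.2⟩
  rw [← heq, ← h.left_eq] at this
  exact hz.1.ne this

theorem derivAt_eq (h : RateData L lam ε a b τ) {z : ℝ} (hz : (z : EReal) ∈ Ioo a b) :
    derivAt L (τ z) = z := by
  have := h.rightLim_eq z ⟨hz.1.le, hz.2⟩
  rw [h.rightLim_rightDeriv_eq (h.mem_Ioo hz)] at this
  exact_mod_cast this

theorem rate_eq (h : RateData L lam ε a b τ) {z : ℝ} (hz : (z : EReal) ∈ Ioo a b) :
    rate L τ z = (L (τ z)).toReal - τ z * z := by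
  have h1 := h.value_derivAt (h.mem_Ioo hz)
  rw [h.derivAt_eq hz, intercept, h.derivAt_eq hz] at h1
  rw [rate, h1, EReal.toReal_coe]

/-- Equality would make `τ z` a local minimum of `L s - s * w`, forcing slope `w` at a point where
the slope is `z`. -/
theorem rate_lt (h : RateData L lam ε a b τ) {z w : ℝ} (hz : (z : EReal) ∈ Ioo a b)
    (hw : (w : EReal) ∈ Ico a b) (hzw : z ≠ w) : rate L τ w < rate L τ z + τ z * (z - w) := by
  refine lt_of_le_of_ne (h.rate_le ⟨hz.1.le, hz.2⟩ hw) fun heq => hzw ?_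
  have ht := h.mem_Ioo hz
  rw [h.rate_eq hz] at heq
  have hmin : IsLocalMin (fun s => (L s).toReal - s * w) (τ z) := by
    filter_upwards [Ioo_mem_nhds ht.1 ht.2] with s hs
    have := h.rate_add_le hw s
    rw [← h.coe_toReal hs, EReal.coe_le_coe_iff] at this
    linarith
  have hd := hmin.hasDerivAt_eq_zero
    ((h.hasDerivAt ht).sub ((hasDerivAt_id (τ z)).mul_const w))
  rw [h.derivAt_eq hz] at hd
  linarith

theorem tau_lt (h : RateData L lam ε a b τ) {z : EReal} (hz : z ∈ Ico a b) : τ z < lam + ε :=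
  (h.mem z hz).2

theorem tau_nonneg (h : RateData L lam ε a b τ) {z : EReal} (hz : z ∈ Ico a b) : 0 ≤ τ z :=
  h.nonneg.trans (h.mem z hz).1

theorem rate_bot (h : RateData L lam ε a b τ) (hz : ⊥ ∈ Ico a b) : rate L τ ⊥ = 0 := by
  obtain ⟨v, hv, -, hv0⟩ := h.exists_value_eq h.cont_zero (h.mem _ hz) (h.rightLim_eq _ hz)
  rw [rate, hv, hv0 rfl, EReal.toReal_coe]

theorem rate_le_zero (h : RateData L lam ε a b τ) {z : EReal} (hz : z ∈ Ico a b) :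
    rate L τ z ≤ 0 := by
  have := h.value_le_zero h.cont_zero (h.mem _ hz) (h.rightLim_eq _ hz)
  rwa [← h.coe_rate hz, EReal.coe_nonpos] at this

theorem rate_strictAntiOn (h : RateData L lam ε a b τ) : StrictAntiOn (rate L τ) (Ico a b) := by
  intro z hz w hw hzw
  -- Since `z` may be `-∞`, or `τ z` may be `0`, strictness comes from an intermediate real `m`,
  -- where `τ m > 0`.
  obtain ⟨m, hzm, hmw⟩ := EReal.lt_iff_exists_real_btwn.1 hzw
  lift w to ℝ using ⟨(hw.2.trans_le le_top).ne, (bot_le.trans_lt hzw).ne'⟩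
  have hm : (m : EReal) ∈ Ioo a b := ⟨hz.1.trans_lt hzm, hmw.trans hw.2⟩
  have hm' := Ioo_subset_Ico_self hm
  have h1 := h.rate_le hm' hw
  have h2 : 0 < τ m := h.nonneg.trans_lt (h.mem_Ioo hm).1
  rw [EReal.coe_lt_coe_iff] at hmw
  have h3 : rate L τ m ≤ rate L τ z := by
    by_cases hbot : z = ⊥
    · subst hbot
      rw [h.rate_bot hz]
      exact h.rate_le_zero hm'
    · lift z to ℝ using ⟨(hzm.trans_le le_top).ne, hbot⟩
      have h4 := h.rate_le hz hm'
      have h5 := h.tau_nonneg hz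
      rw [EReal.coe_lt_coe_iff] at hzm
      nlinarith
  nlinarith

theorem derivAt_mem (h : RateData L lam ε a b τ) {u : ℝ} (hu : u ∈ Ioo lam (lam + ε)) :
    (derivAt L u : EReal) ∈ Ico a b := by
  refine ⟨?_, ?_⟩
  · rw [h.left_eq]
    exact h.rightLim_le_derivAt ⟨le_rfl, h.lt_add⟩ hu.1 hu.2
  · rw [h.right_eq]
    exact h.derivAt_lt_leftLim h.not_max hu

theorem lt (h : RateData L lam ε a b τ) : a < b :=
  have := h.derivAt_mem (u := lam + ε / 2) ⟨by linarith [h.pos], by linarith [h.pos]⟩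
  this.1.trans_lt this.2

theorem value_eq_rate (h : RateData L lam ε a b τ) {t z : ℝ} (hz : (z : EReal) ∈ Ico a b)
    (ht : t ∈ Ico lam (lam + ε)) (htz : Function.rightLim (rightDeriv L) t = z) :
    value L t z = rate L τ z := by
  rw [h.coe_rate hz, h.value_eq_iInf h.cont_zero ht htz,
    h.value_eq_iInf h.cont_zero (h.mem z hz) (h.rightLim_eq z hz)]

theorem rate_derivAt (h : RateData L lam ε a b τ) {u : ℝ} (hu : u ∈ Ioo lam (lam + ε)) :
    rate L τ (derivAt L u) = intercept L u := by
  have := h.value_eq_rate (h.derivAt_mem hu) (Ioo_subset_Ico_self hu) (h.rightLim_rightDeriv_eq hu)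
  rw [h.value_derivAt hu] at this
  exact_mod_cast this.symm

theorem abs_rate_sub_le (h : RateData L lam ε a b τ) {z w : ℝ} (hz : (z : EReal) ∈ Ico a b)
    (hw : (w : EReal) ∈ Ico a b) : |rate L τ w - rate L τ z| ≤ (lam + ε) * |w - z| := by
  wlog hzw : z ≤ w generalizing z w
  · rw [abs_sub_comm, abs_sub_comm w]
    exact this hw hz (le_of_not_ge hzw)
  have h1 := h.rate_le hz hw
  have h2 := h.rate_le hw hz
  have h3 := h.tau_lt hw
  have h4 := h.tau_nonneg hz
  rw [abs_of_nonneg (sub_nonneg.2 hzw), abs_le]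
  constructor <;> nlinarith

theorem rate_continuousOn (h : RateData L lam ε a b τ) : ContinuousOn (rate L τ) (Ico a b) := by
  intro z hz
  by_cases hbot : z = ⊥
  · subst hbot
    have hlim : Tendsto (intercept L) (𝓝[>] (τ ⊥)) (𝓝 0) := by
      obtain ⟨v, hv, hlim, hv0⟩ := h.exists_value_eq h.cont_zero (h.mem _ hz) (h.rightLim_eq _ hz)
      rwa [hv0 rfl] at hlim
    rw [ContinuousWithinAt, h.rate_bot hz]
    refine tendsto_order.2 ⟨fun m hm => ?_, fun m hm => ?_⟩
    · obtain ⟨u, hum, hu⟩ := ((hlim.eventually_const_lt hm).and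
        (Ioo_mem_nhdsGT_of_mem (h.mem _ hz))).exists
      filter_upwards [self_mem_nhdsWithin, mem_nhdsWithin_of_mem_nhds
        (Iio_mem_nhds (EReal.bot_lt_coe (derivAt L u)))] with w hw hwu
      rw [← h.rate_derivAt hu] at hum
      exact hum.trans (h.rate_strictAntiOn hw (h.derivAt_mem hu) hwu)
    · filter_upwards [self_mem_nhdsWithin] with w hw using (h.rate_le_zero hw).trans_lt hm
  · lift z to ℝ using ⟨(hz.2.trans_le le_top).ne, hbot⟩
    have hcont : Tendsto (fun w : EReal => (lam + ε) * |w.toReal - z|) (𝓝[Ico a b] (z : EReal))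
        (𝓝 0) := by
      have h1 : Tendsto EReal.toReal (𝓝[Ico a b] (z : EReal)) (𝓝 z) :=
        (EReal.tendsto_toReal (EReal.coe_ne_top z) (EReal.coe_ne_bot z)).mono_left
          nhdsWithin_le_nhds
      simpa using ((h1.sub_const z).abs.const_mul (lam + ε))
    rw [ContinuousWithinAt, tendsto_iff_norm_sub_tendsto_zero]
    refine squeeze_zero' (Eventually.of_forall fun _ => norm_nonneg _) ?_ hcont
    filter_upwards [self_mem_nhdsWithin, mem_nhdsWithin_of_mem_nhds
      (Ioi_mem_nhds (EReal.bot_lt_coe z))] with w hw hwb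
    have hwb' : ⊥ < w := hwb
    lift w to ℝ using ⟨(hw.2.trans_le le_top).ne, hwb'.ne'⟩
    exact h.abs_rate_sub_le hz hw

/-- Supergradients are bounded by `lam + ε`, so the decrease over a bounded range is bounded; for `b
= ⊤`, the bound `L s - s * z` at one fixed `s > 0` tends to `-∞`. -/
theorem unbounded_iff (h : RateData L lam ε a b τ) :
    (∀ M : ℝ, ∃ z ∈ Ico a b, rate L τ z < M) ↔ b = ⊤ := by
  constructor
  · intro hM
    by_contra hb
    obtain ⟨z₀, haz, hzb⟩ := EReal.lt_iff_exists_real_btwn.1 h.lt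
    have hz₀ : (z₀ : EReal) ∈ Ico a b := ⟨haz.le, hzb⟩
    lift b to ℝ using ⟨hb, (bot_le.trans_lt hzb).ne'⟩
    obtain ⟨z, hz, hlt⟩ := hM (rate L τ z₀ - (lam + ε) * (b - z₀))
    have hpos : 0 < lam + ε := h.nonneg.trans_lt h.lt_add
    rcases le_or_gt z z₀ with hle | hgt
    · have h1 := h.rate_strictAntiOn.antitoneOn hz hz₀ hle
      rw [EReal.coe_lt_coe_iff] at hzb
      nlinarith
    · lift z to ℝ using ⟨(hz.2.trans_le le_top).ne, (bot_le.trans_lt hgt).ne'⟩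
      have h1 := h.rate_le hz hz₀
      have h2 := h.tau_lt hz
      have h3 := hz.2
      rw [EReal.coe_lt_coe_iff] at hgt h3
      have h4 : τ z * (z - z₀) ≤ (lam + ε) * (b - z₀) :=
        mul_le_mul h2.le (by linarith) (by linarith) hpos.le
      linarith
  · rintro rfl M
    obtain ⟨s, hs⟩ := nonempty_Ioo.2 h.lt_add
    have hs0 : 0 < s := h.nonneg.trans_lt hs.1
    set z := max (derivAt L s) (((L s).toReal - M) / s + 1) with hzdef
    have hz : (z : EReal) ∈ Ico a ⊤ :=
      ⟨(h.derivAt_mem hs).1.trans (EReal.coe_le_coe_iff.2 (le_max_left _ _)), EReal.coe_lt_top _⟩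
    refine ⟨z, hz, ?_⟩
    have h1 := h.rate_add_le hz s
    rw [← h.coe_toReal hs, EReal.coe_le_coe_iff] at h1
    have h2 : ((L s).toReal - M) / s < z := (lt_add_one _).trans_le (le_max_right _ _)
    rw [div_lt_iff₀ hs0] at h2
    linarith

/-! ### Strict concavity, differentiability and vanishing of the rate -/

theorem convex_Ioo (a b : EReal) : Convex ℝ {z : ℝ | a < (z : EReal) ∧ (z : EReal) < b} := by
  refine OrdConnected.convex ⟨fun x hx y hy z hz => ⟨?_, ?_⟩⟩
  · exact hx.1.trans_le (EReal.coe_le_coe_iff.2 hz.1)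
  · exact (EReal.coe_le_coe_iff.2 hz.2).trans_lt hy.2

theorem rate_strictConcaveOn (h : RateData L lam ε a b τ) :
    StrictConcaveOn ℝ {z : ℝ | a < (z : EReal) ∧ (z : EReal) < b} (fun z : ℝ => rate L τ z) := by
  refine ⟨convex_Ioo a b, fun z hz w hw hzw p q hp hq hpq => ?_⟩
  have hm := convex_Ioo a b hz hw hp.le hq.le hpq
  simp only [smul_eq_mul] at hm ⊢
  obtain rfl : p = 1 - q := by linarith
  have h1 := h.rate_lt hm ⟨hz.1.le, hz.2⟩ (fun heq => hzw (by
    have : q * (w - z) = 0 := by linarith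
    rcases mul_eq_zero.1 this with h0 | h0 <;> linarith))
  have h2 := h.rate_lt hm ⟨hw.1.le, hw.2⟩ (fun heq => hzw (by
    have : (1 - q) * (z - w) = 0 := by linarith
    rcases mul_eq_zero.1 this with h0 | h0 <;> linarith))
  have h1' := mul_lt_mul_of_pos_left h1 hp
  have h2' := mul_lt_mul_of_pos_left h2 hq
  refine (add_lt_add h1' h2').trans_eq ?_
  ring

theorem rate_differentiableOn (h : RateData L lam ε a b τ)
    (hconv : StrictConvexOn ℝ (Ioo (affineEnd L lam) (lam + ε)) (fun t => (L t).toReal)) :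
    DifferentiableOn ℝ (fun z : ℝ => rate L τ z)
      {z : ℝ | a < (z : EReal) ∧ (z : EReal) < b} := by
  intro z hz
  have hlam : lam ∈ Ico lam (lam + ε) := ⟨le_rfl, h.lt_add⟩
  have hb : Function.rightLim (rightDeriv L) lam < Function.leftLim (leftDeriv L) (lam + ε) := by
    rw [← h.left_eq, ← h.right_eq]
    exact h.lt
  have he := h.affineEnd_mem hlam hb
  have ht := h.mem_Ioo hz
  have hDt := h.derivAt_eq hz
  have het : affineEnd L lam < τ z := by
    by_contra! hle
    have := h.derivAt_eq_rightLim hlam hb ⟨ht.1, hle⟩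
    rw [hDt, ← h.left_eq] at this
    exact hz.1.ne' this
  have hmono : StrictMonoOn (derivAt L) (Ioo (affineEnd L lam) (lam + ε)) :=
    hconv.strictMonoOn_deriv fun x hx => (h.hasDerivAt ⟨he.1.trans_lt hx.1, hx.2⟩).differentiableAt
  have hopen : ∀ᶠ w : ℝ in 𝓝 z, (w : EReal) ∈ Ioo a b :=
    continuous_coe_real_ereal.continuousAt.eventually_mem (Ioo_mem_nhds hz.1 hz.2)
  -- Beyond the affine piece the slope is strictly increasing, and `τ` inverts it, so slopes at
  -- points on either side of `τ z` trap `τ w`.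
  have htau : Tendsto (fun w : ℝ => τ w) (𝓝 z) (𝓝 (τ z)) := by
    refine tendsto_order.2 ⟨fun m hm => ?_, fun m hm => ?_⟩
    · obtain ⟨s, hs1, hs2⟩ := exists_between (max_lt hm het)
      have hsI : s ∈ Ioo (affineEnd L lam) (lam + ε) :=
        ⟨(le_max_right _ _).trans_lt hs1, hs2.trans ht.2⟩
      have hsz : derivAt L s < z := hDt ▸ hmono hsI ⟨het, ht.2⟩ hs2
      filter_upwards [hopen, Ioi_mem_nhds hsz] with w hw hsw
      refine ((le_max_left _ _).trans_lt hs1).trans ?_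
      by_contra! hle
      have := h.monotoneOn (h.mem_Ioo hw) ⟨he.1.trans_lt hsI.1, hsI.2⟩ hle
      rw [h.derivAt_eq hw] at this
      exact this.not_gt hsw
    · obtain ⟨s, hs1, hs2⟩ := exists_between (lt_min hm ht.2)
      have hsI : s ∈ Ioo (affineEnd L lam) (lam + ε) :=
        ⟨het.trans hs1, hs2.trans_le (min_le_right _ _)⟩
      have hsz : z < derivAt L s := hDt ▸ hmono ⟨het, ht.2⟩ hsI hs1
      filter_upwards [hopen, Iio_mem_nhds hsz] with w hw hsw
      refine lt_trans ?_ (hs2.trans_le (min_le_left _ _))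
      by_contra! hle
      have := h.monotoneOn ⟨he.1.trans_lt hsI.1, hsI.2⟩ (h.mem_Ioo hw) hle
      rw [h.derivAt_eq hw] at this
      exact this.not_gt hsw
  have hderiv : HasDerivAt (fun z : ℝ => rate L τ z) (-τ z) z := by
    -- The supergradient inequalities at `z` and at `w` place the error between `-(τ w - τ z) * (w -
    -- z)` and `0`.
    rw [hasDerivAt_iff_isLittleO, Asymptotics.isLittleO_iff]
    intro C hC
    filter_upwards [hopen, Metric.tendsto_nhds.1 htau C hC] with w hw hwC
    rw [Real.dist_eq] at hwC
    have h1 := h.rate_le (Ioo_subset_Ico_self hz) (Ioo_subset_Ico_self hw)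
    have h2 := h.rate_le (Ioo_subset_Ico_self hw) (Ioo_subset_Ico_self hz)
    have h3 : (τ w - τ z) * (w - z) ≤ C * |w - z| := by
      refine (le_abs_self _).trans ?_
      rw [abs_mul]
      gcongr
    rw [Real.norm_eq_abs, Real.norm_eq_abs, smul_eq_mul, abs_le]
    constructor
    · linarith
    · have := mul_nonneg hC.le (abs_nonneg (w - z))
      linarith
  exact hderiv.differentiableAt.differentiableWithinAt

/-- For `lam > 0`, vanishing means that the supporting line of slope `a` passes through the origin.
Chords from the origin give the reverse inequality on `[0, lam]`, so `L` is linear there with slope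
`a`, matching the right derivative. For real `a` and `lam = 0` the rate is `L(0⁺)`, to be compared
with `L 0 = 0`. -/
theorem rate_left_eq_zero_iff (h : RateData L lam ε a b τ) :
    rate L τ a = 0 ↔ (0 < lam ∧ DiffAt L lam ∧ LinearOn L (Icc 0 lam)) ∨
      (lam = 0 ∧ ContinuousWithinAt L (Ici 0) 0) := by
  have hlam : lam ∈ Ico lam (lam + ε) := ⟨le_rfl, h.lt_add⟩
  have ha : a ∈ Ico a b := ⟨le_rfl, h.lt⟩
  by_cases hbot : a = ⊥
  · have ha' := h.left_eq
    subst hbot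
    have h0 := (h.eq_zero_of_rightLim_eq_bot hlam ha'.symm).1
    exact ⟨fun _ => .inr ⟨h0, h.cont_zero h0 (h0 ▸ ha'.symm)⟩, fun _ => h.rate_bot ha⟩
  have hR := h.left_eq.symm
  lift a to ℝ using ⟨(h.lt.trans_le le_top).ne, hbot⟩
  obtain ⟨l, hlL, hl⟩ := h.exists_tendsto hlam
  have hrate : rate L τ a = l - lam * a := by
    have := h.value_eq_rate ha hlam hR
    rw [value, hlL] at this
    exact_mod_cast this.symm
  have hL : Tendsto L (𝓝[>] lam) (𝓝 l) := by
    refine (EReal.tendsto_coe.2 hl).congr' ?_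
    filter_upwards [Ioo_mem_nhdsGT_of_mem hlam] with s hs using h.coe_toReal hs
  rw [hrate]
  rcases h.nonneg.eq_or_lt with h0 | hpos
  · subst h0
    have : ContinuousWithinAt L (Ici 0) 0 ↔ l = 0 := by
      rw [← continuousWithinAt_Ioi_iff_Ici, ContinuousWithinAt, h.zero]
      refine ⟨fun hc => ?_, fun hl0 => by rw [hl0] at hL; exact hL⟩
      exact_mod_cast tendsto_nhds_unique hL hc
    simp [this]
  · have hright : ∀ hc : ContinuousAt (fun s => (L s).toReal) lam,
        HasDerivWithinAt (fun s => (L s).toReal) a (Ici lam) lam := by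
      intro hc
      have hD := h.tendsto_derivAt hlam
      rw [hR, EReal.tendsto_coe] at hD
      exact hasDerivWithinAt_Ici_of_tendsto_deriv
        (fun s hs => (h.hasDerivAt hs).differentiableAt.differentiableWithinAt)
        hc.continuousWithinAt (Ioo_mem_nhdsGT_of_mem hlam) hD
    have huniqL := uniqueDiffWithinAt_Iic lam
    constructor
    · intro hzero
      have hla : l = a * lam := by linarith
      have hsup : ∀ s, ((a * s : ℝ) : EReal) ≤ L s := by
        intro s
        have := h.rate_add_le ha s
        rwa [hrate, hzero, zero_add, mul_comm] at this
      have hlin : ∀ s ∈ Icc 0 lam, L s = ((a * s : ℝ) : EReal) := by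
        intro s hs
        refine le_antisymm ?_ (hsup s)
        have hLw : ∀ w ∈ Ioo lam (lam + ε), L s ≤ ((s / w * (L w).toReal : ℝ) : EReal) := by
          intro w hw
          have hw0 : 0 < w := hpos.trans hw.1
          have hsw : s / w ≤ 1 := (div_le_one hw0).2 (hs.2.trans hw.1.le)
          have := h.conv (sub_nonneg.2 hsw) (div_nonneg hs.1 hw0.le) (sub_add_cancel 1 (s / w))
            (s := 0) (A := 0) (by simp [h.zero]) (h.coe_toReal hw).ge
          rwa [mul_zero, zero_add, zero_add, div_mul_cancel₀ _ hw0.ne'] at this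
        have hid : Tendsto (fun s : ℝ => s) (𝓝[>] lam) (𝓝 lam) := nhdsWithin_le_nhds
        have hlim : Tendsto (fun w => s / w * (L w).toReal) (𝓝[>] lam) (𝓝 (s / lam * l)) :=
          (tendsto_const_nhds.div hid hpos.ne').mul hl
        rw [hla, show s / lam * (a * lam) = a * s by field_simp] at hlim
        refine ge_of_tendsto (EReal.tendsto_coe.2 hlim) ?_
        filter_upwards [Ioo_mem_nhdsGT_of_mem hlam] with w hw using hLw w hw
      have hLlam : (L lam).toReal = l := by
        rw [hlin lam ⟨hpos.le, le_rfl⟩, EReal.toReal_coe, hla]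
      have hleft : HasDerivWithinAt (fun s => (L s).toReal) a (Iic lam) lam := by
        have h1 : HasDerivWithinAt (fun s : ℝ => a * s) a (Iic lam) lam := by
          simpa using ((hasDerivAt_id lam).const_mul a).hasDerivWithinAt
        refine h1.congr_of_eventuallyEq ?_ ?_
        · filter_upwards [self_mem_nhdsWithin, mem_nhdsWithin_of_mem_nhds (Ioi_mem_nhds hpos)]
            with s hs hs0
          rw [hlin s ⟨le_of_lt hs0, hs⟩, EReal.toReal_coe]
        · rw [hlin lam ⟨hpos.le, le_rfl⟩, EReal.toReal_coe]
      have hcont : ContinuousAt (fun s => (L s).toReal) lam := by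
        refine continuousAt_iff_continuous_left'_right'.2
          ⟨hleft.continuousWithinAt.mono Iio_subset_Iic_self, ?_⟩
        rw [ContinuousWithinAt, hLlam]
        exact hl
      have hder : HasDerivAt (fun s => (L s).toReal) a lam := by
        have := hleft.union (hright hcont)
        rwa [Iic_union_Ici, hasDerivWithinAt_univ] at this
      refine .inl ⟨hpos, ⟨?_, hder.differentiableAt⟩, a, hlin⟩
      filter_upwards [Ioo_mem_nhds hpos h.lt_add] with s hs
      rcases le_or_gt s lam with hle | hgt
      · rw [hlin s ⟨hs.1.le, hle⟩]
        exact ⟨EReal.coe_ne_bot _, EReal.coe_ne_top _⟩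
      · exact (h.diff s ⟨hgt, hs.2⟩).1.self_of_nhds
    · rintro (⟨-, hdiff, p, hp⟩ | ⟨h0, -⟩)
      · have hder := hdiff.2.hasDerivAt
        have h1 := (uniqueDiffWithinAt_Ici lam).eq_deriv _ hder.hasDerivWithinAt
          (hright hder.continuousAt)
        have h2 : HasDerivWithinAt (fun s => (L s).toReal) p (Iic lam) lam := by
          have h1 : HasDerivWithinAt (fun s : ℝ => p * s) p (Iic lam) lam := by
            simpa using ((hasDerivAt_id lam).const_mul p).hasDerivWithinAt
          refine h1.congr_of_eventuallyEq ?_ ?_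
          · filter_upwards [self_mem_nhdsWithin, mem_nhdsWithin_of_mem_nhds (Ioi_mem_nhds hpos)]
              with s hs hs0
            rw [hp s ⟨le_of_lt hs0, hs⟩, EReal.toReal_coe]
          · rw [hp lam ⟨hpos.le, le_rfl⟩, EReal.toReal_coe]
        have h3 := huniqL.eq_deriv _ hder.hasDerivWithinAt h2
        have h4 : l = p * lam := by
          refine tendsto_nhds_unique hl ?_
          have := hder.continuousAt.tendsto.mono_left (nhdsWithin_le_nhds (s := Ioi lam))
          rwa [hp lam ⟨hpos.le, le_rfl⟩, EReal.toReal_coe] at this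
        rw [h4, ← h3, h1]
        ring
      · exact absurd h0 hpos.ne'

end RateData

end PlachkySteinebach

end

/-! ### Assembly of the theorem -/

theorem corollary1p2 {ι : Type*} [Preorder ι] [IsDirectedOrder ι] [Nonempty ι]
    -- the net of probability measures and powers
    (μ : ι → Measure ℝ) (hμ : ∀ α, IsProbabilityMeasure (μ α))
    (c : ι → ℝ) (hc : ∀ α, 0 < c α) (hc0 : Tendsto c atTop (𝓝 0))
    -- its generalized log-moment generating function
    (L : ℝ → EReal) (hL : L = PlachkySteinebach.upperLMGF μ c)
    (lam ε : ℝ) (hlam : 0 ≤ lam) (hε : 0 < ε)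
    (hdiff : ∀ t ∈ Ioo lam (lam + ε), PlachkySteinebach.DiffAt L t)
    (hsup : ¬ ∃ m, IsGreatest (PlachkySteinebach.derivAt L '' Ioo lam (lam + ε)) m)
    (hzero : lam = 0 → Function.rightLim (PlachkySteinebach.rightDeriv L) 0 = ⊥ →
      ContinuousWithinAt L (Ici 0) 0)
    -- `a` and `b` are the one-sided limits of the derivative at the two end-points
    (a b : EReal) (ha : a = Function.rightLim (PlachkySteinebach.rightDeriv L) lam)
    (hb : b = Function.leftLim (PlachkySteinebach.leftDeriv L) (lam + ε)) :
    -- part (a)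
    (∀ z ∈ Ico a b,
      (∃ t ∈ Ico lam (lam + ε), Function.rightLim (PlachkySteinebach.rightDeriv L) t = z) ∧
      ∀ t ∈ Ico lam (lam + ε), Function.rightLim (PlachkySteinebach.rightDeriv L) t = z →
        ∀ x y : ι → EReal, Tendsto x atTop (𝓝 z) → z < liminf y atTop →
          limsup (fun α => PlachkySteinebach.logClosed (μ α) (c α) (x α) (y α)) atTop
            = PlachkySteinebach.value L t z ∧
          limsup (fun α => PlachkySteinebach.logOpen (μ α) (c α) (x α) (y α)) atTop
            = PlachkySteinebach.value L t z ∧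
          (z ≠ ⊥ →
            PlachkySteinebach.value L t z = -PlachkySteinebach.legendre L z ∧
            PlachkySteinebach.value L t z = ⨅ s : Ioi (0 : ℝ), (L s - ((s : ℝ) : EReal) * z)) ∧
          (z = ⊥ →
            lam = 0 ∧ a = ⊥ ∧
            Tendsto (fun α => PlachkySteinebach.legendre L (x α)) atTop (𝓝 0) ∧
            PlachkySteinebach.value L t z = 0) ∧
          (∀ u : ℕ → ℝ, (∀ i, PlachkySteinebach.affineEnd L t < u i) →
            Tendsto u atTop (𝓝 (PlachkySteinebach.affineEnd L t)) →
            (∀ i, PlachkySteinebach.LMGFExists μ c (u i)) →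
            Tendsto (fun α => PlachkySteinebach.logClosed (μ α) (c α) (x α) (y α)) atTop
              (𝓝 (PlachkySteinebach.value L t z)) ∧
            Tendsto (fun α => PlachkySteinebach.logOpen (μ α) (c α) (x α) (y α)) atTop
              (𝓝 (PlachkySteinebach.value L t z)))) ∧
    -- part (b), for every choice `z ↦ τ z` of the points of part (a)
    (∀ τ : EReal → ℝ,
      (∀ z ∈ Ico a b, τ z ∈ Ico lam (lam + ε) ∧
        Function.rightLim (PlachkySteinebach.rightDeriv L) (τ z) = z) →
      ∀ G : EReal → EReal, G = (fun z => PlachkySteinebach.value L (τ z) z) →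
        (∀ z ∈ Ico a b, ⊥ < G z ∧ G z ≤ 0) ∧
        StrictAntiOn G (Ico a b) ∧
        ContinuousOn G (Ico a b) ∧
        ((∀ M : ℝ, ∃ z ∈ Ico a b, G z < (M : EReal)) ↔ b = ⊤) ∧
        (G a = 0 ↔
          (0 < lam ∧ PlachkySteinebach.DiffAt L lam ∧
            PlachkySteinebach.LinearOn L (Icc 0 lam)) ∨
          (lam = 0 ∧ ContinuousWithinAt L (Ici 0) 0)) ∧
        StrictConcaveOn ℝ {z : ℝ | a < (z : EReal) ∧ (z : EReal) < b}
          (fun z : ℝ => (G (z : EReal)).toReal) ∧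
        (StrictConvexOn ℝ (Ioo (PlachkySteinebach.affineEnd L lam) (lam + ε))
            (fun t => (L t).toReal) →
          DifferentiableOn ℝ (fun z : ℝ => (G (z : EReal)).toReal)
            {z : ℝ | a < (z : EReal) ∧ (z : EReal) < b})) := by
  obtain rfl := hL
  have h : PlachkySteinebach.ConvexDiff (PlachkySteinebach.upperLMGF μ c) lam ε :=
    { conv := PlachkySteinebach.upperLMGF_convex hc
      zero := PlachkySteinebach.upperLMGF_zero hμ
      nonneg := hlam
      pos := hε
      diff := hdiff }
  refine ⟨fun z hz => ⟨?_, fun t ht htz x y hx hy => ?_⟩, fun τ hτ G hG => ?_⟩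
  -- The left end-point, possibly `-∞`, is realized by `lam` itself; every other `z` is real and is
  -- attained by the intermediate value theorem.
  · rcases hz.1.eq_or_lt with heq | hlt
    · exact ⟨lam, ⟨le_rfl, h.lt_add⟩, by rw [← heq, ha]⟩
    · lift z to ℝ using ⟨(hz.2.trans_le le_top).ne, (bot_le.trans_lt hlt).ne'⟩
      obtain ⟨t, ht, htz⟩ := h.exists_derivAt_eq (ha ▸ hlt) (hb ▸ hz.2)
      exact ⟨t, Ioo_subset_Ico_self ht, by rw [h.rightLim_rightDeriv_eq ht, htz]⟩
  · have hzb := hz.2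
    rw [hb] at hzb
    have hupper := h.limsup_logClosed_le hμ hc hzero ht htz y hx
    have hlower := h.le_limsup_logOpen hc hc0 hzero ht htz hzb hx hy
    have hmono : ∀ α, PlachkySteinebach.logOpen (μ α) (c α) (x α) (y α) ≤
        PlachkySteinebach.logClosed (μ α) (c α) (x α) (y α) :=
      fun α => PlachkySteinebach.logOpen_le_logClosed (hc α) _ _
    have hmid := limsup_le_limsup (f := atTop) (Eventually.of_forall hmono)
    refine ⟨le_antisymm hupper (hlower.trans hmid), le_antisymm (hmid.trans hupper) hlower,
      fun hbot => ?_, fun hbot => ?_, fun u hu hulim hex => ?_⟩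
    · lift z to ℝ using ⟨(hz.2.trans_le le_top).ne, hbot⟩
      exact ⟨h.value_eq_neg_legendre hzero ht htz, h.value_eq_iInf hzero ht htz⟩
    · subst hbot
      obtain ⟨v, hv, -, hv0⟩ := h.exists_value_eq hzero ht htz
      refine ⟨(h.eq_zero_of_rightLim_eq_bot ht htz).2, le_bot_iff.1 hz.1,
        (h.tendsto_legendre_bot hzero ht htz).comp hx, ?_⟩
      rw [hv, hv0 rfl, EReal.coe_zero]
    · have hliminf := h.le_liminf_logOpen hc hc0 hzero ht htz hzb hx hy hu hulim hex
      exact ⟨tendsto_of_le_liminf_of_limsup_le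
        (hliminf.trans (liminf_le_liminf (Eventually.of_forall hmono))) hupper,
        tendsto_of_le_liminf_of_limsup_le hliminf (hmid.trans hupper)⟩
  · have hR : PlachkySteinebach.RateData (PlachkySteinebach.upperLMGF μ c) lam ε a b τ :=
      { h with
        cont_zero := hzero
        left_eq := ha
        right_eq := hb
        not_max := hsup
        mem := fun z hz => (hτ z hz).1
        rightLim_eq := fun z hz => (hτ z hz).2 }
    set g := PlachkySteinebach.rate (PlachkySteinebach.upperLMGF μ c) τ with hg
    have hGg : ∀ z ∈ Ico a b, G z = (g z : EReal) := fun z hz => by rw [hG, hR.coe_rate hz]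
    have hGreal : (fun z : ℝ => (G (z : EReal)).toReal) = fun z : ℝ => g z := by rw [hG]; rfl
    refine ⟨fun z hz => ?_, fun z hz w hw hzw => ?_, ?_, ?_, ?_, ?_, fun hconv => ?_⟩
    · rw [hGg z hz]
      exact ⟨EReal.bot_lt_coe _, EReal.coe_nonpos.2 (hR.rate_le_zero hz)⟩
    · rw [hGg z hz, hGg w hw, EReal.coe_lt_coe_iff]
      exact hR.rate_strictAntiOn hz hw hzw
    · exact (continuous_coe_real_ereal.comp_continuousOn hR.rate_continuousOn).congr hGg
    · rw [← hR.unbounded_iff]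
      refine forall_congr' fun M => exists_congr fun z => and_congr_right fun hz => ?_
      rw [hGg z hz, EReal.coe_lt_coe_iff]
    · rw [hGg a ⟨le_rfl, hR.lt⟩, ← hR.rate_left_eq_zero_iff, EReal.coe_eq_zero]
    · rw [hGreal]
      exact hR.rate_strictConcaveOn
    · rw [hGreal]
      exact hR.rate_differentiableOn hconv
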